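/- Let $k$ be an algebraically closed field and let $\mathcal A$ be an abelian 1-Calabi-Yau category over $k$, i.e. a $k$-linear abelian category in which all spaces $\operatorname{Hom}(X,Y)$ and $\operatorname{Ext}^i(X,Y)$ are finite dimensional over $k$ and which admits $k$-linear isomorphisms $\operatorname{Hom}(X,Y)\cong \operatorname{Ext}^1(Y,X)^*$ natural in $X$ and $Y$. Assume that $\mathcal A$ is connected: any two indecomposable objects are joined by an unoriented path of non-zero maps between indecomposable objects. An object $S$ is called endo-simple if $\operatorname{End}(S)\cong k$ as $k$-algebras. For an endo-simple object $S$ let $\mathcal A_S$ be the full subcategory of the objects obtained from $S$ by finitely many extensions with itself, i.e. having a finite filtration with all factors isomorphic to $S$ (the zero object included). Then: 1. Every indecomposable object $X$ lies in $\mathcal A_S$ for some endo-simple object $S$, and $S$ is unique up to isomorphism. 2. Every Auslander–Reiten component of $\mathcal A$ is a homogeneous tube based on an endo-simple object: for every indecomposable $X$ there is an endo-simple $S$ such that the indecomposable objects in the component of $X$ are exactly the indecomposable objects of $\mathcal A_S$, and the component is of the form $\mathbb Z A_\infty/\langle\tau\rangle$ with bottom vertex $S$. That is, these indecomposables are, up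 to isomorphism, pairwise non-isomorphic objects $T_0\cong S, T_1,T_2,\dots$, with $\dim_k \operatorname{rad}(T_m,T_n)/\operatorname{rad}^2(T_m,T_n)$ equal to $1$ if $|m-n|=1$ and $0$ otherwise, and for every $n$ there is an almost split sequence $0\to T_n\to E_n\to T_n\to 0$ (so $\tau T_n\cong T_n$). 3. For every endo-simple object $S$, the category $\mathcal A_S$ is $k$-linearly equivalent to the category of those $k[[t]]$-modules that are finite dimensional over $k$. 4. If $X_0\to X_1\to\cdots\to X_n\to X_0$ ($n\ge 0$) is a cycle of non-zero non-isomorphisms between indecomposable objects, then all $X_i$ lie in a single Auslander–Reiten component, which is a homogeneous tube based on an endo-simple object. -/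

import Mathlib

open CategoryTheory CategoryTheory.Limits CategoryTheory.Abelian

universe w v u t

noncomputable section

namespace OneCY

/-- An abelian 1-Calabi-Yau category over `k`: a `k`-linear, `Hom`/`Ext`-finite abelian category
admitting isomorphisms `Hom(X, Y) ≅ Ext¹(Y, X)^*` which are `k`-linear and natural in both
variables. -/
structure IsOneCalabiYau (k : Type t) [Field k] (C : Type u) [Category.{v} C] [Abelian C]
    [Linear k C] [HasExt.{w} C] : Prop where
  hom_finite : ∀ X Y : C, Module.Finite k (X ⟶ Y)
  ext_finite : ∀ (X Y : C) (i : ℕ), Module.Finite k (Ext.{w} X Y i)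
  duality : ∃ η : ∀ X Y : C, (X ⟶ Y) ≃ₗ[k] Module.Dual k (Ext.{w} Y X 1),
    (∀ (X' X Y : C) (f : X' ⟶ X) (g : X ⟶ Y) (e : Ext.{w} Y X' 1),
      η X' Y (f ≫ g) e = η X Y g (e.comp (Ext.mk₀ f) (add_zero 1))) ∧
    (∀ (X Y Y' : C) (g : X ⟶ Y) (h : Y ⟶ Y') (e : Ext.{w} Y' X 1),
      η X Y' (g ≫ h) e = η X Y g ((Ext.mk₀ h).comp e (zero_add 1)))

/-- Any two indecomposable objects are joined by an unoriented path of nonzero morphisms between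
indecomposable objects. -/
def IsConnectedAbelian (C : Type u) [Category.{v} C] [Abelian C] : Prop :=
  ∀ X Y : C, Indecomposable X → Indecomposable Y →
    Relation.EqvGen
      (fun A B : C => Indecomposable A ∧ Indecomposable B ∧ ∃ f : A ⟶ B, f ≠ 0) X Y

section Basic

variable (k : Type t) [Field k] {C : Type u} [Category.{v} C] [Abelian C] [Linear k C]

/-- `S` is endo-simple if `End S ≅ k`. -/
def EndoSimple (S : C) : Prop := Nonempty (End S ≃ₐ[k] k)

/-- The (Jacobson) radical `rad(X, Y)` of the category: those `f : X ⟶ Y` such that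
`𝟙 X - f ≫ g` is invertible for all `g : Y ⟶ X`. -/
def radical (X Y : C) : Submodule k (X ⟶ Y) where
  carrier := {f | ∀ g : Y ⟶ X, IsIso (𝟙 X - f ≫ g)}
  zero_mem' := fun g => by
    rw [zero_comp, sub_zero]
    infer_instance
  add_mem' := by
    intro f f' hf hf' g
    have := hf g
    have := hf' (g ≫ inv (𝟙 X - f ≫ g))
    have h : 𝟙 X - (f + f') ≫ g =
        (𝟙 X - f' ≫ g ≫ inv (𝟙 X - f ≫ g)) ≫ (𝟙 X - f ≫ g) := by
      rw [Preadditive.sub_comp, Category.assoc, Category.assoc, IsIso.inv_hom_id,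
        Category.comp_id, Category.id_comp, Preadditive.add_comp]
      abel
    rw [h]
    infer_instance
  smul_mem' := by
    intro c f hf g
    have := hf (c • g)
    rwa [Linear.smul_comp, ← Linear.comp_smul]

/-- `rad²(X, Y)`: the span of the composites of two radical morphisms. -/
def radicalSq (X Y : C) : Submodule k (X ⟶ Y) :=
  Submodule.span k {h | ∃ (Z : C) (f : X ⟶ Z) (g : Z ⟶ Y),
    f ∈ radical k X Z ∧ g ∈ radical k Z Y ∧ f ≫ g = h}

/-- The space `Irr(X, Y) = rad(X, Y) / rad²(X, Y)` of irreducible morphisms. -/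
abbrev Irr (X Y : C) : Type _ := radical k X Y ⧸ (radicalSq k X Y).submoduleOf (radical k X Y)

/-- The Auslander–Reiten component of `X`. The vertices of the Auslander–Reiten quiver are the
isomorphism classes of indecomposable objects, and there are `dim Irr(A, B)` arrows from `A` to
`B`; this is the class of those indecomposable objects whose vertex lies in the same connected
component of the quiver as the vertex of `X`. -/
def ARComponent (X : C) : ObjectProperty C := fun Y =>
  Indecomposable X ∧ Indecomposable Y ∧
    Relation.EqvGen (fun A B : C => Indecomposable A ∧ Indecomposable B ∧
      (Nonempty (A ≅ B) ∨ Nontrivial (Irr k A B))) X Y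

end Basic

section Sequences

variable {C : Type u} [Category.{v} C] [Abelian C]

/-- An almost split (Auslander–Reiten) sequence `0 ⟶ X₁ ⟶ X₂ ⟶ X₃ ⟶ 0`; it witnesses that the
Auslander–Reiten translate of `X₃` is `X₁`. -/
structure IsAlmostSplit (E : ShortComplex C) : Prop where
  shortExact : E.ShortExact
  indecomposable_left : Indecomposable E.X₁
  indecomposable_right : Indecomposable E.X₃
  not_split : ¬ Nonempty E.Splitting
  left_almost_split : ∀ (W : C) (h : E.X₁ ⟶ W), ¬ IsSplitMono h → ∃ l : E.X₂ ⟶ W, E.f ≫ l = h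
  right_almost_split : ∀ (W : C) (h : W ⟶ E.X₃), ¬ IsSplitEpi h → ∃ l : W ⟶ E.X₂, l ≫ E.g = h

/-- `IteratedSelfExt S` is the class of the objects obtained from `S` by finitely many extensions
with itself, i.e. of the objects having a finite filtration all of whose factors are isomorphic
to `S` (the zero object has the filtration of length `0`). -/
inductive IteratedSelfExt (S : C) : ObjectProperty C
  | zero (Z : C) (hZ : IsZero Z) : IteratedSelfExt S Z
  | extension (E : ShortComplex C) (hE : E.ShortExact) (h₁ : IteratedSelfExt S E.X₁)
      (h₃ : Nonempty (E.X₃ ≅ S)) : IteratedSelfExt S E.X₂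

end Sequences

section Tubes

variable (k : Type t) [Field k] {C : Type u} [Category.{v} C] [Abelian C] [Linear k C]

/-- The class `P` of indecomposable objects is (the vertex set of) a homogeneous tube
`ℤA_∞ / ⟨τ⟩` with bottom vertex `S`. The vertices of this translation quiver are `0, 1, 2, …`, there
is exactly one arrow `n → n + 1` and one arrow `n + 1 → n` for each `n`, there are no other arrows,
and the translation `τ` is the identity; `T n` is the object at the vertex `n`. -/
def IsHomogeneousTube (P : ObjectProperty C) (S : C) : Prop :=
  ∃ T : ℕ → C, Nonempty (T 0 ≅ S) ∧
    (∀ n, Indecomposable (T n)) ∧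
    (∀ m n, Nonempty (T m ≅ T n) → m = n) ∧
    (∀ Y, P Y ↔ ∃ n, Nonempty (Y ≅ T n)) ∧
    (∀ m n, Module.Finite k (Irr k (T m) (T n)) ∧
      Module.finrank k (Irr k (T m) (T n)) = if n = m + 1 ∨ m = n + 1 then 1 else 0) ∧
    (∀ n, ∃ E : ShortComplex C, IsAlmostSplit E ∧
      Nonempty (E.X₁ ≅ T n) ∧ Nonempty (E.X₃ ≅ T n))

/-- The `k[[t]]`-modules which are finite dimensional over `k`. -/
def fdPowerSeriesModules : ObjectProperty (ModuleCat.{t} (PowerSeries k)) := fun M =>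
  letI : Module k M := ModuleCat.moduleOfAlgebraModule M
  Module.Finite k M

end Tubes

end OneCY

end

/-! Under the duality, a short exact sequence `0 → A → E → X → 0` becomes a linear functional on
`Hom(A, X)`, and every functional occurs. A morphism `W ⟶ X` lifts to `E`, or a morphism `A ⟶ W`
extends to `E`, exactly when the functional kills all its composites (`IsPairing`,
`IsOneCalabiYau.isPaired`). Everything after that uses morphism spaces alone. Comparing ranks of the
pairing shows that `dim Hom(X, Y) - dim Hom(Y, X)` is additive on short exact sequences
(`euler_add`).

The main lever is `exists_ne_zero_of_not_mono`: if a nonzero map `S ⟶ X` from an endo-simple to an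
indecomposable object is not mono, its image still maps nontrivially to every target that `X` does.
Otherwise `X` would have ever smaller quotients whose Euler form against `S` grows without bound.
Hence endo-simple objects with nonzero maps both ways are isomorphic, and a cycle of nonzero maps
between endo-simples can be shortened until this applies. This yields uniqueness of `S` and the
statement on cycles.

Existence (`exists_endoSimple`) is by induction on `dim End X`. If `X` is not endo-simple, some
endo-simple `S` is both a quotient and a subobject of `X`. According to the sign of the Euler form
of `X` against `S`, the kernel of `X ⟶ S` or the cokernel of `S ⟶ X` has a smaller endomorphism
ring, and a squeeze on its Euler form puts all its summands in the class of `S`.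

For fixed `S`, iterated extension by `S` with functionals that do not vanish on the socle gives a
tower `T 0, T 1, …` with one-dimensional socle and top. The maps among its members are polynomials
in one nilpotent endomorphism followed by projections (`Ladder.exists_eq_ev_proj`). An
indecomposable `X` in the class of `S` is some `T n`: a map `S ⟶ X` can be extended up the tower
until it stops, and there `T n` splits off. Irreducible maps and almost split sequences are read off
from this, and `X ↦ colim Hom(T n, X)` is the equivalence with finite dimensional `k[[t]]`-modules.
-/

noncomputable section

namespace OneCY

/-! ### Degree-one Ext classes as short exact sequences. -/

section Realization

open Pretriangulated DerivedCategory

variable {C : Type u} [Category.{v} C] [Abelian C] [HasExt.{w} C]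

/-- Every class in `Ext X A 1` is the class of a short exact sequence. -/
theorem exists_shortExact_extClass {X A : C} (e : Ext.{w} X A 1) :
    ∃ (E : C) (f : A ⟶ E) (g : E ⟶ X) (zero : f ≫ g = 0)
      (hS : (ShortComplex.mk f g zero).ShortExact), hS.extClass = e := by
  let := HasDerivedCategory.standard C
  obtain ⟨D, f', g', hD⟩ := distinguished_cocone_triangle₂
    (Z := (singleFunctor C 0).obj X) (X := (singleFunctor C 0).obj A) e.hom
  -- An extension of two complexes with cohomology only in degree `0` is again of this kind, so `D`
  -- comes from an object of `C`.
  have : D.IsGE 0 := TStructure.t.isGE₂ _ hD 0 (inferInstanceAs (((singleFunctor C 0).obj A).IsGE 0))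
    (inferInstanceAs (((singleFunctor C 0).obj X).IsGE 0))
  have : D.IsLE 0 := TStructure.t.isLE₂ _ hD 0 (inferInstanceAs (((singleFunctor C 0).obj A).IsLE 0))
    (inferInstanceAs (((singleFunctor C 0).obj X).IsLE 0))
  obtain ⟨E, ⟨φ⟩⟩ := exists_iso_singleFunctor_obj_of_isGE_of_isLE D 0
  obtain ⟨f, hf⟩ := (singleFunctor C 0).map_surjective (f' ≫ φ.hom)
  obtain ⟨g, hg⟩ := (singleFunctor C 0).map_surjective (φ.inv ≫ g')
  let T : Triangle (DerivedCategory C) :=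
    Triangle.mk ((singleFunctor C 0).map f) ((singleFunctor C 0).map g) e.hom
  have hT : T ∈ distTriang (DerivedCategory C) :=
    isomorphic_distinguished _ hD _
      (Triangle.isoMk _ _ (Iso.refl ((singleFunctor C 0).obj A)) φ.symm
        (Iso.refl ((singleFunctor C 0).obj X))
        (show (singleFunctor C 0).map f ≫ φ.inv = 𝟙 _ ≫ f' by simp [hf])
        (show (singleFunctor C 0).map g ≫ 𝟙 _ = φ.inv ≫ g' by simp [hg])
        (show e.hom ≫ (shiftFunctor _ (1 : ℤ)).map (𝟙 ((singleFunctor C 0).obj A)) = 𝟙 _ ≫ e.hom by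
          simp))
  have zero : f ≫ g = 0 := by
    apply (singleFunctor C 0).map_injective
    rw [Functor.map_comp, Functor.map_zero]
    exact comp_distTriang_mor_zero₁₂ _ hT
  let S := ShortComplex.mk f g zero
  let i := S.mapNatIso (singleFunctorCompHomologyFunctorIso C 0)
  have hS : S.ShortExact := by
    refine ShortComplex.shortExact_of_iso i ?_
    refine @ShortComplex.ShortExact.mk _ _ _ _ (HomologySequence.exact₂ T hT 0) ?_ ?_
    · refine (HomologySequence.mono_homologyMap_mor₁_iff T hT (-1) 0).2 ?_
      exact (isZero_of_isGE ((singleFunctor C 0).obj X) 0 (-1) (by lia)).eq_of_src _ _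
    · refine (HomologySequence.epi_homologyMap_mor₂_iff T hT 0 1).2 ?_
      exact (isZero_of_isLE ((singleFunctor C 0).obj A) 0 1 (by lia)).eq_of_tgt _ _
  refine ⟨E, f, g, zero, hS, ?_⟩
  -- Compare the triangle of the new sequence with `T`. The comparison is the identity on `A` and
  -- `E`, hence also on `X` because `g` is epi, so the two connecting maps agree.
  obtain ⟨c, hc₁, hc₂⟩ := complete_distinguished_triangle_morphism _ _
    hS.singleTriangle_distinguished hT (𝟙 ((singleFunctor C 0).obj A))
    (𝟙 ((singleFunctor C 0).obj E))
    (show (singleFunctor C 0).map f ≫ 𝟙 _ = 𝟙 _ ≫ (singleFunctor C 0).map f by simp)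
  change (singleFunctor C 0).obj X ⟶ (singleFunctor C 0).obj X at c
  change (singleFunctor C 0).map g ≫ c = 𝟙 _ ≫ (singleFunctor C 0).map g at hc₁
  change hS.singleδ ≫ (shiftFunctor _ (1 : ℤ)).map (𝟙 ((singleFunctor C 0).obj A)) =
    c ≫ e.hom at hc₂
  obtain ⟨c', rfl⟩ := (singleFunctor C 0).map_surjective c
  have := hS.epi_g
  have hc' : c' = 𝟙 X := by
    rw [← cancel_epi S.g]
    apply (singleFunctor C 0).map_injective
    rw [Functor.map_comp, hc₁, Category.id_comp, Category.comp_id]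
  rw [hc', CategoryTheory.Functor.map_id, CategoryTheory.Functor.map_id, Category.id_comp, Category.comp_id] at hc₂
  ext
  rw [hS.extClass_hom, hc₂]

end Realization

/-! ### Calabi–Yau duality expressed through morphism spaces. -/

section Functional

variable {k : Type t} [Field k] {C : Type u} [Category.{v} C] [Abelian C] [Linear k C]

/-- The short complex `S` has the pairing functional `l` on `Hom(S.X₁, S.X₃)`: a morphism lifts
along `S.g`, or extends along `S.f`, exactly when `l` annihilates its composites. -/
structure IsPairing (S : ShortComplex C) (l : (S.X₁ ⟶ S.X₃) →ₗ[k] k) : Prop where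
  shortExact : S.ShortExact
  lift_iff : ∀ {W : C} (h : W ⟶ S.X₃), (∃ l' : W ⟶ S.X₂, l' ≫ S.g = h) ↔
    ∀ u : S.X₁ ⟶ W, l (u ≫ h) = 0
  desc_iff : ∀ {W : C} (h : S.X₁ ⟶ W), (∃ l' : S.X₂ ⟶ W, S.f ≫ l' = h) ↔
    ∀ u : W ⟶ S.X₃, l (h ≫ u) = 0

variable (k C) in
/-- The consequences of the one-dimensional Calabi-Yau property that are used below: a self-dual
reformulation which mentions only morphism spaces. -/
structure IsPaired : Prop where
  hom_finite : ∀ X Y : C, Module.Finite k (X ⟶ Y)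
  exists_pairing : ∀ S : ShortComplex C, S.ShortExact → ∃ l, IsPairing (k := k) S l
  exists_shortComplex : ∀ (A X : C) (l : (A ⟶ X) →ₗ[k] k),
    ∃ (E : C) (f : A ⟶ E) (g : E ⟶ X) (zero : f ≫ g = 0), IsPairing (ShortComplex.mk f g zero) l

/-- The functional attached to a sequence is `f ↦ η f` evaluated at its class. By the long exact Ext
sequences the obstruction to lifting or extending is a product with that class; naturality of `η`
rewrites its vanishing in terms of the functional. -/
theorem IsOneCalabiYau.isPaired [HasExt.{w} C] (h : IsOneCalabiYau.{w} k C) : IsPaired k C := by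
  obtain ⟨η, h₁, h₂⟩ := h.duality
  have := h.hom_finite
  have key : ∀ (S : ShortComplex C) (hS : S.ShortExact) (l : (S.X₁ ⟶ S.X₃) →ₗ[k] k),
      (∀ f, l f = η S.X₁ S.X₃ f hS.extClass) → IsPairing S l := by
    intro S hS l hl
    -- Every functional on `Ext¹` has the form `η X Y u`, so these functionals separate classes.
    have vanish : ∀ {X Y : C} (e : Ext.{w} Y X 1), (∀ u, η X Y u e = 0) → e = 0 := by
      intro X Y e he
      have := h.ext_finite Y X 1
      rw [← Module.forall_dual_apply_eq_zero_iff k]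
      intro φ
      simpa using he ((η X Y).symm φ)
    refine ⟨hS, fun {W} a => ⟨?_, fun ha => ?_⟩, fun {W} a => ⟨?_, fun ha => ?_⟩⟩
    · rintro ⟨b, rfl⟩ u
      rw [hl, h₂, ← Ext.mk₀_comp_mk₀_assoc, hS.comp_extClass, Ext.comp_zero, map_zero]
    · have h0 : (Ext.mk₀ a).comp hS.extClass (zero_add 1) = 0 :=
        vanish _ fun u => by rw [← h₂, ← hl]; exact ha u
      obtain ⟨b, hb⟩ := Ext.covariant_sequence_exact₃ _ hS (Ext.mk₀ a) (zero_add 1) h0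
      obtain ⟨b, rfl⟩ := (Ext.mk₀_bijective _ _).2 b
      rw [Ext.mk₀_comp_mk₀] at hb
      exact ⟨b, (Ext.mk₀_bijective _ _).1 hb⟩
    · rintro ⟨b, rfl⟩ u
      rw [hl, Category.assoc, h₁, hS.extClass_comp, map_zero]
    · have h0 : hS.extClass.comp (Ext.mk₀ a) (add_zero 1) = 0 :=
        vanish _ fun u => by rw [← h₁, ← hl]; exact ha u
      obtain ⟨b, hb⟩ := Ext.contravariant_sequence_exact₁ hS _ (Ext.mk₀ a) (add_zero 1) h0
      obtain ⟨b, rfl⟩ := (Ext.mk₀_bijective _ _).2 b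
      rw [Ext.mk₀_comp_mk₀] at hb
      exact ⟨b, (Ext.mk₀_bijective _ _).1 hb⟩
  refine ⟨h.hom_finite, fun S hS => ⟨LinearMap.flip (η S.X₁ S.X₃).toLinearMap hS.extClass,
    key S hS _ fun f => rfl⟩, fun A X l => ?_⟩
  have := h.ext_finite X A 1
  -- Transported along `η`, `l` is a functional on the dual of `Ext¹`; by finite dimensionality it
  -- is evaluation at a class `e`.
  let e := (Module.evalEquiv k (Ext.{w} X A 1)).symm (l ∘ₗ (η A X).symm.toLinearMap)
  obtain ⟨E, f, g, zero, hS, he⟩ := exists_shortExact_extClass e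
  refine ⟨E, f, g, zero, key _ hS l fun a => ?_⟩
  rw [he]
  have := Module.apply_evalEquiv_symm_apply k (Ext.{w} X A 1) (η A X a)
    (l ∘ₗ (η A X).symm.toLinearMap)
  simp only [e]
  rw [this]
  simp

end Functional

/-! ### Dimensions of morphism spaces and the Euler form. -/

theorem finrank_range_flip {K M N : Type*} [Field K] [AddCommGroup M] [Module K M]
    [AddCommGroup N] [Module K N] [Module.Finite K M] [Module.Finite K N]
    (B : M →ₗ[K] N →ₗ[K] K) :
    Module.finrank K (LinearMap.range B.flip) = Module.finrank K (LinearMap.range B) := by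
  rw [← LinearMap.finrank_range_dualMap_eq_finrank_range B]
  have : LinearMap.range B.flip = LinearMap.range (LinearMap.dualMap B) := by
    have : B.flip = (LinearMap.dualMap B) ∘ₗ (Module.evalEquiv K N).toLinearMap := by
      ext; simp
    rw [this, LinearMap.range_comp, LinearEquiv.range, Submodule.map_top]
  rw [this]

section HomDim

variable (k : Type t) [Field k] {C : Type u} [Category.{v} C] [Abelian C] [Linear k C]

/-- The dimension of a morphism space. -/
def homDim (X Y : C) : ℕ := Module.finrank k (X ⟶ Y)

/-- The antisymmetrized dimension of morphism spaces, which equals the Euler form for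
1-Calabi-Yau categories. -/
def euler (X Y : C) : ℤ := homDim k X Y - homDim k Y X

variable {k}

theorem homDim_pos_iff (hP : IsPaired k C) {X Y : C} :
    0 < homDim k X Y ↔ ∃ f : X ⟶ Y, f ≠ 0 := by
  have := hP.hom_finite X Y
  unfold homDim
  rw [Module.finrank_pos_iff, nontrivial_iff_exists_ne (0 : X ⟶ Y)]

theorem homDim_eq_zero_iff (hP : IsPaired k C) {X Y : C} :
    homDim k X Y = 0 ↔ ∀ f : X ⟶ Y, f = 0 := by
  rw [← not_iff_not, ← ne_eq, ← Nat.pos_iff_ne_zero, homDim_pos_iff hP]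
  push Not
  rfl

theorem homDim_congr {X X' Y Y' : C} (e : X ≅ X') (e' : Y ≅ Y') :
    homDim k X Y = homDim k X' Y' :=
  (Linear.homCongr k e e').finrank_eq

theorem euler_self (X : C) : euler k X X = 0 := by simp [euler]

theorem euler_congr {X X' Y Y' : C} (e : X ≅ X') (e' : Y ≅ Y') :
    euler k X Y = euler k X' Y' := by
  rw [euler, euler, homDim_congr e e', homDim_congr e' e]

theorem homDim_le_of_mono (hP : IsPaired k C) {X Y : C} (f : X ⟶ Y) [Mono f] (Z : C) :
    homDim k Z X ≤ homDim k Z Y := by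
  have := hP.hom_finite Z X
  have := hP.hom_finite Z Y
  exact LinearMap.finrank_le_finrank_of_injective (f := Linear.rightComp k Z f)
    fun a b h => (cancel_mono f).1 h

theorem homDim_le_of_epi (hP : IsPaired k C) {X Y : C} (f : X ⟶ Y) [Epi f] (Z : C) :
    homDim k Y Z ≤ homDim k X Z := by
  have := hP.hom_finite X Z
  have := hP.hom_finite Y Z
  exact LinearMap.finrank_le_finrank_of_injective (f := Linear.leftComp k Z f)
    fun a b h => (cancel_epi f).1 h

section ShortExact

variable {S : ShortComplex C}

theorem homDim_eq_add_range_right (hP : IsPaired k C) (hS : S.ShortExact) (Y : C) :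
    homDim k Y S.X₂ = homDim k Y S.X₁ +
      Module.finrank k (LinearMap.range (Linear.rightComp k Y S.g)) := by
  have := hP.hom_finite Y S.X₂
  have := hS.mono_f
  rw [homDim, homDim, ← LinearMap.finrank_range_add_finrank_ker (Linear.rightComp k Y S.g),
    add_comm]
  congr 1
  have hr : LinearMap.ker (Linear.rightComp k Y S.g) =
      LinearMap.range (Linear.rightComp k Y S.f) := by
    ext x
    simp only [LinearMap.mem_ker, Linear.rightComp_apply, LinearMap.mem_range]
    refine ⟨fun hx => ⟨hS.exact.lift x hx, hS.exact.lift_f x hx⟩, ?_⟩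
    rintro ⟨y, rfl⟩
    simp
  rw [hr]
  exact LinearMap.finrank_range_of_inj fun a b h => (cancel_mono S.f).1 h

theorem homDim_eq_add_range_left (hP : IsPaired k C) (hS : S.ShortExact) (Y : C) :
    homDim k S.X₂ Y = homDim k S.X₃ Y +
      Module.finrank k (LinearMap.range (Linear.leftComp k Y S.f)) := by
  have := hP.hom_finite S.X₂ Y
  have := hS.epi_g
  rw [homDim, homDim, ← LinearMap.finrank_range_add_finrank_ker (Linear.leftComp k Y S.f),
    add_comm]
  congr 1
  have hr : LinearMap.ker (Linear.leftComp k Y S.f) =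
      LinearMap.range (Linear.leftComp k Y S.g) := by
    ext x
    simp only [LinearMap.mem_ker, Linear.leftComp_apply, LinearMap.mem_range]
    refine ⟨fun hx => ⟨hS.exact.desc x hx, hS.exact.g_desc x hx⟩, ?_⟩
    rintro ⟨y, rfl⟩
    simp
  rw [hr]
  exact LinearMap.finrank_range_of_inj fun a b h => (cancel_epi S.g).1 h

/-- The covariant and the contravariant defect of a short exact sequence have equal dimension. -/
theorem defect_eq (hP : IsPaired k C) (hS : S.ShortExact) (Y : C) :
    homDim k Y S.X₃ + Module.finrank k (LinearMap.range (Linear.leftComp k Y S.f)) =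
      homDim k S.X₁ Y + Module.finrank k (LinearMap.range (Linear.rightComp k Y S.g)) := by
  obtain ⟨l, hl⟩ := hP.exists_pairing S hS
  have := hP.hom_finite Y S.X₃
  have := hP.hom_finite S.X₁ Y
  -- The pairing property says that the left and right kernels of this form are the two ranges in
  -- question. The defects are thus the row rank and the column rank of one bilinear form.
  let B : (S.X₁ ⟶ Y) →ₗ[k] (Y ⟶ S.X₃) →ₗ[k] k := (Linear.comp S.X₁ Y S.X₃).compr₂ l
  have h₁ : LinearMap.ker B = LinearMap.range (Linear.leftComp k Y S.f) := by
    ext x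
    rw [LinearMap.mem_ker, LinearMap.mem_range]
    refine Iff.trans ?_ (hl.desc_iff x).symm
    rw [LinearMap.ext_iff]
    rfl
  have h₂ : LinearMap.ker B.flip = LinearMap.range (Linear.rightComp k Y S.g) := by
    ext x
    rw [LinearMap.mem_ker, LinearMap.mem_range]
    refine Iff.trans ?_ (hl.lift_iff x).symm
    rw [LinearMap.ext_iff]
    rfl
  have h₃ := LinearMap.finrank_range_add_finrank_ker B
  have h₄ := LinearMap.finrank_range_add_finrank_ker B.flip
  rw [finrank_range_flip, h₂] at h₄
  rw [h₁] at h₃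
  unfold homDim
  omega

theorem euler_add (hP : IsPaired k C) (hS : S.ShortExact) (Y : C) :
    euler k S.X₂ Y = euler k S.X₁ Y + euler k S.X₃ Y := by
  have h₁ := defect_eq hP hS Y
  have h₂ := homDim_eq_add_range_left hP hS Y
  have h₃ := homDim_eq_add_range_right hP hS Y
  unfold euler
  omega

/-- The two sides differ by the rank of `Hom(Y, X₂) → Hom(Y, X₃)`. With `Y = S.X₁` this bounds the
endomorphism ring of a kernel; `homDim_right_le` does the same for a cokernel. -/
theorem homDim_left_le (hP : IsPaired k C) (hS : S.ShortExact) (Y : C) :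
    homDim k S.X₁ Y + homDim k S.X₃ Y ≤ homDim k S.X₂ Y + homDim k Y S.X₃ := by
  have h₁ := defect_eq hP hS Y
  have h₂ := homDim_eq_add_range_left hP hS Y
  omega

theorem homDim_right_le (hP : IsPaired k C) (hS : S.ShortExact) (Y : C) :
    homDim k Y S.X₃ + homDim k Y S.X₁ ≤ homDim k Y S.X₂ + homDim k S.X₁ Y := by
  have h₁ := defect_eq hP hS Y
  have h₂ := homDim_eq_add_range_right hP hS Y
  omega

/-- Here the attached functional lives on the zero space, so nothing obstructs lifting the identity.
-/
theorem exists_section_of_forall_eq_zero (hP : IsPaired k C) (hS : S.ShortExact)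
    (h : ∀ f : S.X₁ ⟶ S.X₃, f = 0) : ∃ s : S.X₃ ⟶ S.X₂, s ≫ S.g = 𝟙 _ := by
  obtain ⟨l, hl⟩ := hP.exists_pairing S hS
  exact (hl.lift_iff _).2 fun u => by rw [h (u ≫ _), map_zero]

end ShortExact

end HomDim

/-! ### Indecomposable objects, retracts and idempotents. -/

section Indec

variable {C : Type u} [Category.{v} C] [Abelian C]

/-- A retract of an indecomposable object is zero or everything. -/
theorem _root_.CategoryTheory.Indecomposable.isIso_of_retract {X L : C} (hX : Indecomposable X) (hL : ¬ IsZero L)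
    (i : L ⟶ X) (p : X ⟶ L) (h : i ≫ p = 𝟙 L) : IsIso i ∧ IsIso p := by
  have : Epi p := epi_of_epi_fac h
  let S := ShortComplex.mk (kernel.ι p) p (kernel.condition p)
  have hS : S.Exact := ShortComplex.exact_kernel p
  let σ := ShortComplex.Splitting.ofExactOfSection S hS i h (inferInstanceAs (Mono (kernel.ι p)))
  have hz : IsZero (kernel p) := (hX.2 _ _ σ.isoBinaryBiproduct).resolve_right hL
  have : Mono p := Preadditive.mono_of_isZero_kernel p hz
  have hp : IsIso p := isIso_of_mono_of_epi p
  exact ⟨by rw [(IsIso.eq_comp_inv p).2 h]; infer_instance, hp⟩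

theorem indecomposable_of_idempotents {X : C} (h0 : ¬ IsZero X)
    (h : ∀ e : X ⟶ X, e ≫ e = e → e = 0 ∨ e = 𝟙 X) : Indecomposable X := by
  refine ⟨h0, fun Y Z φ => ?_⟩
  rcases h (φ.hom ≫ biprod.fst ≫ biprod.inl ≫ φ.inv) (by simp) with h | h
  · left
    rw [IsZero.iff_id_eq_zero]
    have := congrArg (fun t => biprod.inl ≫ φ.inv ≫ t ≫ φ.hom ≫ biprod.fst) h
    simpa using this
  · right
    rw [IsZero.iff_id_eq_zero]
    have := congrArg (fun t => biprod.inr ≫ φ.inv ≫ t ≫ φ.hom ≫ biprod.snd) h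
    simpa using this.symm

theorem _root_.CategoryTheory.Indecomposable.of_iso {X Y : C} (hX : Indecomposable X) (e : X ≅ Y) : Indecomposable Y :=
  ⟨fun h => hX.1 (h.of_iso e), fun A B φ => hX.2 A B (e ≪≫ φ)⟩

theorem _root_.CategoryTheory.Indecomposable.idempotent {X : C} (hX : Indecomposable X) (e : X ⟶ X) (he : e ≫ e = e) :
    e = 0 ∨ e = 𝟙 X := by
  by_cases h0 : IsZero (Limits.image e)
  · left
    rw [← Limits.image.fac e, h0.eq_of_tgt (Limits.factorThruImage e) 0, zero_comp]
  · right
    have h : Limits.image.ι e ≫ Limits.factorThruImage e = 𝟙 _ := by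
      rw [← cancel_epi (Limits.factorThruImage e), ← cancel_mono (Limits.image.ι e)]
      simp [he]
    obtain ⟨h₁, h₂⟩ := hX.isIso_of_retract h0 _ _ h
    have : IsIso e := by rw [← Limits.image.fac e]; infer_instance
    rw [← cancel_epi e, he, Category.comp_id]

variable {k : Type t} [Field k] [Linear k C]

/-- An element of a finite dimensional algebra without nontrivial idempotents is a unit or
nilpotent. -/
theorem isUnit_or_isNilpotent {A : Type*} [Ring A] [Algebra k A] [Module.Finite k A]
    (h : ∀ e : A, e * e = e → e = 0 ∨ e = 1) (a : A) : IsUnit a ∨ IsNilpotent a := by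
  have ha : IsIntegral k a := Algebra.IsIntegral.isIntegral a
  have hne : minpoly k a ≠ 0 := minpoly.ne_zero ha
  obtain ⟨q, hq, hndvd⟩ := Polynomial.exists_eq_pow_rootMultiplicity_mul_and_not_dvd
    (minpoly k a) hne 0
  rw [map_zero, sub_zero] at hq hndvd
  set m := Polynomial.rootMultiplicity 0 (minpoly k a)
  -- The Bézout relation gives the Fitting idempotent `Y * Q`. The exponent `m + 1` instead of `m`
  -- leaves a factor `a` to invert even when `m = 0`.
  have hco : IsCoprime (Polynomial.X ^ (m + 1)) q :=
    ((Polynomial.irreducible_X.coprime_iff_not_dvd).2 hndvd).pow_left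
  obtain ⟨x, y, hxy⟩ := hco
  have h0 : a ^ (m + 1) * Polynomial.aeval a q = 0 := by
    have := minpoly.aeval k a
    rw [hq, map_mul, map_pow, Polynomial.aeval_X] at this
    rw [pow_succ', mul_assoc, this, mul_zero]
  have h1 : Polynomial.aeval a x * a ^ (m + 1) + Polynomial.aeval a y * Polynomial.aeval a q = 1 := by
    have := congrArg (Polynomial.aeval a) hxy
    simpa using this
  have hc : ∀ p r : Polynomial k, Polynomial.aeval a p * Polynomial.aeval a r =
      Polynomial.aeval a r * Polynomial.aeval a p := fun p r => by
    rw [← map_mul, mul_comm, map_mul]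
  set X := Polynomial.aeval a x
  set Y := Polynomial.aeval a y
  set Q := Polynomial.aeval a q
  have hYQ : a ^ (m + 1) * (Y * Q) = 0 := by rw [hc y q, ← mul_assoc, h0, zero_mul]
  rcases h (Y * Q) (by
    have := congrArg (· * (Y * Q)) h1
    simpa [add_mul, mul_assoc, hYQ] using this) with h2 | h2
  · left
    rw [h2, add_zero] at h1
    refine ⟨⟨a, X * a ^ m, ?_, ?_⟩, rfl⟩
    · have := hc Polynomial.X x
      rw [Polynomial.aeval_X] at this
      rw [← mul_assoc, ← h1, this, mul_assoc, ← pow_succ']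
    · rw [mul_assoc, ← pow_succ, h1]
  · right
    exact ⟨m + 1, by rw [h2, mul_one] at hYQ; exact hYQ⟩

end Indec

/-! ### Short exact sequences and pullbacks. -/

section Abelian

variable {C : Type u} [Category.{v} C] [Abelian C]

theorem shortExact_cokernel {A X : C} (f : A ⟶ X) [Mono f] :
    (ShortComplex.mk f (cokernel.π f) (cokernel.condition f)).ShortExact :=
  @ShortComplex.ShortExact.mk _ _ _ _ (ShortComplex.exact_cokernel f)
    (inferInstanceAs (Mono f)) (inferInstanceAs (Epi (cokernel.π f)))

theorem shortExact_kernel {X A : C} (g : X ⟶ A) [Epi g] :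
    (ShortComplex.mk (kernel.ι g) g (kernel.condition g)).ShortExact :=
  @ShortComplex.ShortExact.mk _ _ _ _ (ShortComplex.exact_kernel g)
    (inferInstanceAs (Mono (kernel.ι g))) (inferInstanceAs (Epi g))

theorem shortExact_biprod (A B : C) :
    (ShortComplex.mk (biprod.inl : A ⟶ A ⊞ B) biprod.snd (by simp)).ShortExact :=
  (ShortComplex.Splitting.ofHasBinaryBiproduct A B).shortExact

/-- A short complex is short exact when its first map is a monomorphism through which every
morphism killed by the epimorphism `g` factors. -/
theorem shortExact_of_lift {S : ShortComplex C} (hf : Mono S.f) (hg : Epi S.g)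
    (h : ∀ {W : C} (x : W ⟶ S.X₂), x ≫ S.g = 0 → ∃ y : W ⟶ S.X₁, y ≫ S.f = x) :
    S.ShortExact := by
  refine @ShortComplex.ShortExact.mk _ _ _ _ ?_ hf hg
  obtain ⟨y, hy⟩ := h (kernel.ι S.g) (kernel.condition _)
  refine ShortComplex.exact_of_f_is_kernel _ ?_
  exact KernelFork.IsLimit.ofι' _ _ fun x hx => ⟨(h x hx).choose, (h x hx).choose_spec⟩

section Pullback

variable {S : ShortComplex C} (hS : S.ShortExact) {G : C} (m : G ⟶ S.X₃)

include hS in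
theorem shortExact_pullback_left :
    (ShortComplex.mk (pullback.lift S.f 0 (by rw [S.zero, zero_comp]) : S.X₁ ⟶ pullback S.g m)
      (pullback.snd S.g m) (pullback.lift_snd _ _ _)).ShortExact := by
  have := hS.epi_g
  have := hS.mono_f
  refine shortExact_of_lift ?_ (inferInstanceAs (Epi (pullback.snd S.g m))) ?_
  · exact mono_of_mono_fac (pullback.lift_fst (f := S.g) (g := m) S.f 0 _)
  · intro W x hx
    change x ≫ pullback.snd S.g m = 0 at hx
    refine ⟨hS.exact.lift (x ≫ pullback.fst S.g m) ?_, ?_⟩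
    · rw [Category.assoc, pullback.condition, reassoc_of% hx, zero_comp]
    · change _ ≫ pullback.lift S.f 0 _ = x
      apply pullback.hom_ext
      · rw [Category.assoc, pullback.lift_fst, hS.exact.lift_f]
      · rw [Category.assoc, pullback.lift_snd, comp_zero, hx]

include hS in
-- The pullback is the preimage of the subobject `G`; the quotient by it is the quotient of `S.X₃`
-- by `G`.
theorem shortExact_pullback_right [Mono m] {Q : C} (g : S.X₃ ⟶ Q) (w : m ≫ g = 0)
    (h : (ShortComplex.mk m g w).ShortExact) :
    (ShortComplex.mk (pullback.fst S.g m) (S.g ≫ g)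
      (by rw [pullback.condition_assoc, w, comp_zero])).ShortExact := by
  have := hS.epi_g
  have : Epi g := h.epi_g
  refine shortExact_of_lift (inferInstanceAs (Mono (pullback.fst S.g m)))
    (inferInstanceAs (Epi (S.g ≫ g))) ?_
  intro W x hx
  change x ≫ S.g ≫ g = 0 at hx
  obtain ⟨y, hy⟩ : ∃ y : W ⟶ G, y ≫ m = x ≫ S.g :=
    ⟨h.exact.lift (x ≫ S.g) (by simpa using hx), h.exact.lift_f _ _⟩
  exact ⟨pullback.lift x y hy.symm, pullback.lift_fst _ _ _⟩

end Pullback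

end Abelian

/-! ### Endo-simple objects and nonzero morphisms between them. -/

section Endo

variable {k : Type t} [Field k] {C : Type u} [Category.{v} C] [Abelian C] [Linear k C]

theorem _root_.CategoryTheory.Indecomposable.isIso_or_isNilpotent (hP : IsPaired k C) {X : C}
    (hX : Indecomposable X) (f : End X) : IsIso (C := C) f ∨ IsNilpotent f := by
  have : Module.Finite k (End X) := hP.hom_finite X X
  rw [← isUnit_iff_isIso]
  exact isUnit_or_isNilpotent (A := End X) (k := k) (fun e he => hX.idempotent e he) f

theorem _root_.CategoryTheory.Indecomposable.isIso_id_sub (hP : IsPaired k C) {X : C}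
    (hX : Indecomposable X) (f : X ⟶ X) (hf : ¬ IsIso f) : IsIso (𝟙 X - f) := by
  have h := (hX.isIso_or_isNilpotent hP f).resolve_left hf
  exact (isUnit_iff_isIso (X := X) ((1 : End X) - (show End X from f))).1 h.isUnit_one_sub

theorem _root_.CategoryTheory.Indecomposable.isIso_of_isIso_comp {X Y : C} (hX : ¬ IsZero X)
    (hY : Indecomposable Y) (f : X ⟶ Y) (g : Y ⟶ X) [IsIso (f ≫ g)] : IsIso f ∧ IsIso g := by
  have h := hY.isIso_of_retract hX f (g ≫ inv (f ≫ g)) (by rw [← Category.assoc, IsIso.hom_inv_id])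
  have := h.2
  exact ⟨h.1, IsIso.of_isIso_comp_right g (inv (f ≫ g))⟩

theorem endoSimple_iff {S : C} :
    EndoSimple k S ↔ ¬ IsZero S ∧ ∀ f : S ⟶ S, ∃ c : k, f = c • 𝟙 S := by
  constructor
  · rintro ⟨e⟩
    refine ⟨fun h => ?_, fun f => ⟨e (f : End S), ?_⟩⟩
    · have h1 : (1 : End S) = 0 := (IsZero.iff_id_eq_zero S).1 h
      have := congrArg e h1
      rw [map_one, map_zero] at this
      exact one_ne_zero this
    · have h1 : (f : End S) = e (f : End S) • (1 : End S) := 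
        e.injective (by rw [map_smul, map_one, smul_eq_mul, mul_one])
      exact h1
  · rintro ⟨h0, h⟩
    have hne : 𝟙 S ≠ 0 := fun h' => h0 ((IsZero.iff_id_eq_zero S).2 h')
    have : Nontrivial (End S) := ⟨⟨1, 0, hne⟩⟩
    refine ⟨(AlgEquiv.ofBijective (Algebra.ofId k (End S)) ⟨?_, fun f => ?_⟩).symm⟩
    · exact (algebraMap k (End S)).injective
    · obtain ⟨c, hc⟩ := h f
      exact ⟨c, (Algebra.algebraMap_eq_smul_one c).trans hc.symm⟩

theorem EndoSimple.not_isZero {S : C} (h : EndoSimple k S) : ¬ IsZero S := (endoSimple_iff.1 h).1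

theorem EndoSimple.id_ne_zero {S : C} (h : EndoSimple k S) : 𝟙 S ≠ 0 :=
  fun h' => h.not_isZero ((IsZero.iff_id_eq_zero S).2 h')

theorem EndoSimple.isIso {S : C} (h : EndoSimple k S) {f : S ⟶ S} (hf : f ≠ 0) : IsIso f := by
  obtain ⟨c, rfl⟩ := (endoSimple_iff.1 h).2 f
  have hc : c ≠ 0 := by rintro rfl; simp at hf
  exact ⟨c⁻¹ • 𝟙 S, by simp [smul_smul, hc], by simp [smul_smul, hc]⟩

theorem EndoSimple.indecomposable {S : C} (h : EndoSimple k S) : Indecomposable S :=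
  indecomposable_of_idempotents h.not_isZero fun e he => by
    by_cases h0 : e = 0
    · exact Or.inl h0
    · have := h.isIso h0
      right
      rw [← cancel_epi e, he, Category.comp_id]

theorem EndoSimple.of_iso {S S' : C} (h : EndoSimple k S) (e : S ≅ S') : EndoSimple k S' := by
  rw [endoSimple_iff] at h ⊢
  refine ⟨fun h' => h.1 (h'.of_iso e), fun f => ?_⟩
  obtain ⟨c, hc⟩ := h.2 (e.hom ≫ f ≫ e.inv)
  refine ⟨c, ?_⟩
  have := congrArg (fun t => e.inv ≫ t ≫ e.hom) hc
  simpa using this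

/-- An endomorphism of `S` has an eigenvalue `c`, and the non-invertible `c - f` must vanish. -/
theorem endoSimple_of_forall_isIso [IsAlgClosed k] (hP : IsPaired k C) {S : C} (h0 : ¬ IsZero S)
    (h : ∀ f : S ⟶ S, f ≠ 0 → IsIso f) : EndoSimple k S := by
  refine endoSimple_iff.2 ⟨h0, fun f => ?_⟩
  have : Module.Finite k (End S) := hP.hom_finite S S
  have hne : 𝟙 S ≠ 0 := fun h' => h0 ((IsZero.iff_id_eq_zero S).2 h')
  have : Nontrivial (End S) := ⟨⟨1, 0, hne⟩⟩
  obtain ⟨c, hc⟩ := spectrum.nonempty_of_isAlgClosed_of_finiteDimensional k (A := End S) f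
  refine ⟨c, ?_⟩
  by_contra hfc
  refine hc ?_
  rw [spectrum.mem_resolventSet_iff, Algebra.algebraMap_eq_smul_one, isUnit_iff_isIso]
  exact h _ fun h' => hfc (sub_eq_zero.1 h').symm

theorem isIso_of_epi_endo (hP : IsPaired k C) {S : C} (h : S ⟶ S) [Epi h] : IsIso h := by
  have := hP.hom_finite S S
  have hinj : Function.Injective (Linear.leftComp k S h) := fun a b hab => (cancel_epi h).1 hab
  obtain ⟨r, hr⟩ := (LinearMap.injective_iff_surjective.1 hinj) (𝟙 S)
  have : Mono h := mono_of_mono_fac hr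
  exact isIso_of_mono_of_epi h

/-- Maps out of an indecomposable object that receives a non-injective map from an endo-simple
object are detected on the image of the latter. -/
theorem exists_ne_zero_of_not_mono (hP : IsPaired k C) {S X Y : C} (hS : EndoSimple k S)
    (hX : Indecomposable X) (a : S ⟶ X) (ha : a ≠ 0) (ham : ¬ Mono a) (b : X ⟶ Y) (hb : b ≠ 0) :
    ∃ c : Limits.image a ⟶ Y, c ≠ 0 := by
  by_contra! hcon
  set I := Limits.image a
  let q : S ⟶ I := Limits.factorThruImage a
  let i : I ⟶ X := Limits.image.ι a
  have hqi : q ≫ i = a := Limits.image.fac a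
  have hq : Epi q := inferInstanceAs (Epi (Limits.factorThruImage a))
  have hi : Mono i := inferInstanceAs (Mono (Limits.image.ι a))
  -- A nonzero `I ⟶ S` would make `S ⟶ I ⟶ S` invertible, hence `q` and then `a` mono.
  have hIS : ∀ f : I ⟶ S, f = 0 := by
    intro f
    by_contra hf
    have : IsIso (q ≫ f) := hS.isIso fun h => hf ((cancel_epi q).1 (h.trans comp_zero.symm))
    have : Mono q := mono_of_mono q f
    exact ham (hqi ▸ inferInstance)
  have hG : ∀ {G : C} (p : I ⟶ G), Epi p → p ≠ 0 → euler k G S ≤ -1 := by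
    intro G p hp hp0
    have h1 := homDim_le_of_epi hP p S
    rw [(homDim_eq_zero_iff hP).2 hIS] at h1
    have h2 : 0 < homDim k S G :=
      (homDim_pos_iff hP).2 ⟨q ≫ p, fun h => hp0 ((cancel_epi q).1 (h.trans comp_zero.symm))⟩
    unfold euler
    omega
  -- `A` is a growing subobject of `X` containing `I` and filtered by quotients of `I`, the latter
  -- recorded only as: whatever receives no map from `I` receives none from `A`. Each enlargement
  -- removes from `U` a nonzero quotient of `I`, raising its Euler form by at least one.
  have key : ∀ n : ℕ, ∃ (A U : C) (j : A ⟶ X) (p : X ⟶ U) (z : j ≫ p = 0),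
      (ShortComplex.mk j p z).ShortExact ∧ i ≫ p = 0 ∧
      (∀ W : C, (∀ f : I ⟶ W, f = 0) → ∀ g : A ⟶ W, g = 0) ∧
      euler k (cokernel i) S + n ≤ euler k U S := by
    intro n
    induction n with
    | zero =>
      exact ⟨I, cokernel i, i, cokernel.π i, cokernel.condition i, shortExact_cokernel i,
        cokernel.condition i, fun W h => h, by simp⟩
    | succ n ih =>
      obtain ⟨A, U, j, p, z, hSE, hip, hA, hn⟩ := ih
      have hp : Epi p := hSE.epi_g
      -- If `I` has no maps to `U`, neither has `A`, so the sequence splits. Indecomposability of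
      -- `X` leaves `U = 0`, against `b ≠ 0`, or `p` invertible, against `a ≠ 0`.
      by_cases hIU : ∀ f : I ⟶ U, f = 0
      · exfalso
        obtain ⟨s, hs⟩ := exists_section_of_forall_eq_zero hP hSE (hA U hIU)
        change s ≫ p = 𝟙 U at hs
        by_cases hU : IsZero U
        · have hj : Epi j := hSE.exact.epi_f (hU.eq_of_tgt _ _)
          exact hb ((cancel_epi j).1 ((hA Y hcon (j ≫ b)).trans comp_zero.symm))
        · have := (hX.isIso_of_retract hU s p hs).2
          have hi0 : i = 0 := (cancel_mono p).1 (hip.trans zero_comp.symm)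
          exact ha (by rw [← hqi, hi0, comp_zero])
      · push Not at hIU
        obtain ⟨v, hv⟩ := hIU
        let m := Limits.image.ι v
        let e := Limits.factorThruImage v
        have he : e ≫ m = v := Limits.image.fac v
        have hm := shortExact_cokernel m
        refine ⟨pullback p m, cokernel m, pullback.fst p m, p ≫ cokernel.π m, _,
          shortExact_pullback_right hSE m _ _ hm, by rw [reassoc_of% hip, zero_comp], ?_, ?_⟩
        · intro W hW g
          have hl := shortExact_pullback_left hSE m
          have hg := hA W hW (pullback.lift j 0 (by simp [z]) ≫ g)
          have hsnd : Epi (pullback.snd p m) := hl.epi_g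
          have hg' : pullback.snd p m ≫ hl.exact.desc g hg = g := hl.exact.g_desc g hg
          have h0 : hl.exact.desc g hg = 0 := by
            change (_ : Limits.image v ⟶ W) = 0
            rw [← cancel_epi e, comp_zero]
            exact hW _
          rw [← hg', h0, comp_zero]
        · have h1 := euler_add hP hm S
          have h2 : euler k (Limits.image v) S ≤ -1 :=
            hG e inferInstance fun h => hv (by rw [← he, h, zero_comp])
          change euler k U S = euler k (Limits.image v) S + euler k (cokernel m) S at h1
          push_cast
          omega
  -- So many steps force `euler k U S` above `homDim k X S`, which bounds it because `U` is a
  -- quotient of `X`.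
  obtain ⟨A, U, j, p, z, hSE, -, -, hn⟩ := key (homDim k X S + 1 + (-euler k (cokernel i) S).toNat)
  have hp : Epi p := hSE.epi_g
  have h1 := homDim_le_of_epi hP p S
  have h2 : euler k U S ≤ homDim k U S := by unfold euler; omega
  have h3 := Int.self_le_toNat (-euler k (cokernel i) S)
  push_cast at hn
  omega

/-- If `a` were not mono, its image would map nontrivially to `S`; the composite endomorphism of `S`
would be invertible, making `a` mono after all. -/
theorem EndoSimple.mono_of_ne_zero (hP : IsPaired k C) {S X : C} (hS : EndoSimple k S)
    (hX : Indecomposable X) (a : S ⟶ X) (ha : a ≠ 0) (b : X ⟶ S) (hb : b ≠ 0) : Mono a := by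
  by_contra ham
  obtain ⟨c, hc⟩ := exists_ne_zero_of_not_mono hP hS hX a ha ham b hb
  have : IsIso (Limits.factorThruImage a ≫ c) := hS.isIso fun h =>
    hc ((cancel_epi _).1 (h.trans comp_zero.symm))
  have : Mono (Limits.factorThruImage a) := mono_of_mono _ c
  exact ham (Limits.image.fac a ▸ inferInstance)

/-- `b` is mono, so `a ≫ b` is a nonzero, hence invertible, endomorphism of `S`, and `a` is a split
mono into an indecomposable object. -/
theorem EndoSimple.nonempty_iso (hP : IsPaired k C) {S S' : C} (hS : EndoSimple k S)
    (hS' : EndoSimple k S') (a : S ⟶ S') (ha : a ≠ 0) (b : S' ⟶ S) (hb : b ≠ 0) :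
    Nonempty (S ≅ S') := by
  have := hS'.mono_of_ne_zero hP hS.indecomposable b hb a ha
  have : IsIso (a ≫ b) := hS.isIso fun h => ha ((cancel_mono b).1 (h.trans zero_comp.symm))
  have := (hS'.indecomposable.isIso_of_isIso_comp hS.not_isZero a b).1
  exact ⟨asIso a⟩

variable (k) in
/-- Two endo-simple objects joined by a nonzero morphism. -/
def HomRel (A B : C) : Prop := EndoSimple k A ∧ EndoSimple k B ∧ ∃ f : A ⟶ B, f ≠ 0

/-- If `B ⟶ D` is mono, composition with it stays nonzero and `B` can be skipped. Otherwise its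
image maps to everything that `D` maps to, and `D` can be skipped. -/
theorem HomRel.shortcut (hP : IsPaired k C) {A B D : C} (h₁ : HomRel k A B) (h₂ : HomRel k B D) :
    HomRel k A D ∨ ∀ E, HomRel k D E → HomRel k B E := by
  obtain ⟨hA, hB, a, ha⟩ := h₁
  obtain ⟨-, hD, b, hb⟩ := h₂
  by_cases hbm : Mono b
  · exact Or.inl ⟨hA, hD, a ≫ b, fun h => ha ((cancel_mono b).1 (h.trans zero_comp.symm))⟩
  · refine Or.inr fun E ⟨_, hE, e, he⟩ => ⟨hB, hE, ?_⟩
    obtain ⟨c, hc⟩ := exists_ne_zero_of_not_mono hP hB hD.indecomposable b hb hbm e he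
    exact ⟨Limits.factorThruImage b ≫ c, fun h => hc ((cancel_epi _).1 (h.trans comp_zero.symm))⟩

theorem HomRel.nonempty_iso_of_symm (hP : IsPaired k C) {A B : C} (h₁ : HomRel k A B)
    (h₂ : HomRel k B A) : Nonempty (A ≅ B) := by
  obtain ⟨hA, hB, a, ha⟩ := h₁
  obtain ⟨-, -, b, hb⟩ := h₂
  exact hA.nonempty_iso hP hB a ha b hb

variable (k) in
/-- Paths of length `n + 1` of nonzero morphisms between endo-simple objects. -/
def HomPath : ℕ → C → C → Prop
  | 0, A, B => HomRel k A B
  | n + 1, A, B => ∃ D, HomRel k A D ∧ HomPath n D B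

/-- The cycle loses `B` or `D` by `HomRel.shortcut`. When `B` is skipped, induction identifies `A`
with `D`, and then `B ⟶ D` closes a two-cycle between `A` and `B`. -/
theorem HomPath.nonempty_iso (hP : IsPaired k C) (n : ℕ) : ∀ {A B : C}, HomRel k A B →
    HomPath k n B A → Nonempty (A ≅ B) := by
  induction n with
  | zero => exact fun h₁ h₂ => h₁.nonempty_iso_of_symm hP h₂
  | succ n ih =>
    rintro A B h₁ ⟨D, h₂, h₃⟩
    rcases h₁.shortcut hP h₂ with h | h
    · obtain ⟨e⟩ := ih h h₃
      obtain ⟨hB, -, b, hb⟩ := h₂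
      exact h₁.nonempty_iso_of_symm hP ⟨hB, h₁.1, b ≫ e.inv, fun h' =>
        hb (by simpa using h' =≫ e.hom)⟩
    · refine ih h₁ ?_
      cases n with
      | zero => exact h _ h₃
      | succ n =>
        obtain ⟨E, h₄, h₅⟩ := h₃
        exact ⟨E, h _ h₄, h₅⟩

theorem HomRel.nonempty_iso_of_transGen (hP : IsPaired k C) {A B : C} (h₁ : HomRel k A B)
    (h₂ : Relation.TransGen (HomRel k) B A) : Nonempty (A ≅ B) := by
  have : ∃ n, HomPath k n B A := by
    clear h₁
    induction h₂ using Relation.TransGen.head_induction_on with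
    | single h => exact ⟨0, h⟩
    | head h _ ih =>
      obtain ⟨n, hn⟩ := ih
      exact ⟨n + 1, _, h, hn⟩
  obtain ⟨n, hn⟩ := this
  exact HomPath.nonempty_iso hP n h₁ hn

end Endo

/-! ### The class of iterated self-extensions. -/

section IteratedSelfExt

variable {C : Type u} [Category.{v} C] [Abelian C]

theorem shortExact_of_iso_middle {S : ShortComplex C} (hS : S.ShortExact) {Y : C} (e : S.X₂ ≅ Y) :
    (ShortComplex.mk (S.f ≫ e.hom) (e.inv ≫ S.g) (by simp)).ShortExact :=
  ShortComplex.shortExact_of_iso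
    (ShortComplex.isoMk (S₁ := S) (Iso.refl S.X₁) e (Iso.refl S.X₃) (by simp) (by simp)) hS

namespace IteratedSelfExt

variable {S : C}

theorem of_iso {X Y : C} (hX : IteratedSelfExt S X) (e : X ≅ Y) : IteratedSelfExt S Y := by
  cases hX with
  | zero _ hZ => exact .zero _ (hZ.of_iso e.symm)
  | extension E hE h₁ h₃ => exact .extension _ (shortExact_of_iso_middle hE e) h₁ h₃

/-- A filtration of the quotient is pulled back to the middle term, where it continues the
filtration of the subobject. -/
theorem of_shortExact {E : ShortComplex C} (hE : E.ShortExact) (h₁ : IteratedSelfExt S E.X₁)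
    (h₃ : IteratedSelfExt S E.X₃) : IteratedSelfExt S E.X₂ := by
  obtain @⟨X₁, X₂, X₃, f, g, w⟩ := E
  dsimp only at h₁ h₃ ⊢
  induction h₃ generalizing X₂ with
  | zero Z hZ =>
    have := hE.mono_f
    have : Epi f := hE.exact.epi_f (hZ.eq_of_tgt _ _)
    have : IsIso f := isIso_of_mono_of_epi f
    exact h₁.of_iso (asIso f)
  | extension E' hE' _ h₃ ih =>
    have := hE'.mono_f
    exact .extension _ (shortExact_pullback_right hE E'.f E'.g E'.zero hE')
      (ih _ _ _ (shortExact_pullback_left hE E'.f)) h₃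

open ZeroObject in
theorem self (S : C) : IteratedSelfExt S S := by
  have hm : Mono (0 : (0 : C) ⟶ S) := ⟨fun _ _ _ => (isZero_zero C).eq_of_tgt _ _⟩
  have he : Epi (𝟙 S) := inferInstance
  exact .extension (ShortComplex.mk (0 : (0 : C) ⟶ S) (𝟙 S) (by simp))
    (shortExact_of_lift hm he fun {W} (x : W ⟶ S) hx =>
      ⟨0, (zero_comp (X := W) (f := (0 : (0 : C) ⟶ S))).trans
        (((Category.comp_id x).symm.trans hx).symm)⟩)
    (.zero _ (isZero_zero C)) ⟨Iso.refl _⟩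

theorem biprod {X Y : C} (hX : IteratedSelfExt S X) (hY : IteratedSelfExt S Y) :
    IteratedSelfExt S (X ⊞ Y) :=
  of_shortExact (shortExact_biprod X Y) hX hY

theorem congr {S' : C} (e : S ≅ S') {X : C} (hX : IteratedSelfExt S X) : IteratedSelfExt S' X := by
  induction hX with
  | zero Z hZ => exact .zero Z hZ
  | extension E hE _ h₃ ih => exact .extension E hE ih ⟨h₃.some ≪≫ e⟩

theorem exists_hom_right {X Y : C} (hX : IteratedSelfExt S X) (f : Y ⟶ X) (hf : f ≠ 0) :
    ∃ g : Y ⟶ S, g ≠ 0 := by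
  induction hX with
  | zero Z hZ => exact absurd (hZ.eq_of_tgt f 0) hf
  | extension E hE _ h₃ ih =>
    by_cases h : f ≫ E.g = 0
    · have := hE.mono_f
      refine ih (hE.exact.lift f h) fun h' => hf ?_
      rw [← hE.exact.lift_f f h, h', zero_comp]
    · exact ⟨f ≫ E.g ≫ h₃.some.hom, fun h' => h (by simpa using h' =≫ h₃.some.inv)⟩

theorem exists_hom_left {X Y : C} (hX : IteratedSelfExt S X) (f : X ⟶ Y) (hf : f ≠ 0) :
    ∃ g : S ⟶ Y, g ≠ 0 := by
  induction hX with
  | zero Z hZ => exact absurd (hZ.eq_of_src f 0) hf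
  | extension E hE _ h₃ ih =>
    by_cases h : E.f ≫ f = 0
    · have := hE.epi_g
      refine ⟨h₃.some.inv ≫ hE.exact.desc f h, fun h' => hf ?_⟩
      have h'' : hE.exact.desc f h = 0 := by simpa using h₃.some.hom ≫= h'
      rw [← hE.exact.g_desc f h, h'', comp_zero]
    · exact ih (E.f ≫ f) h

variable {k : Type t} [Field k] [Linear k C]

theorem euler_eq_zero (hP : IsPaired k C) {X Y : C} (hX : IteratedSelfExt S X)
    (hY : euler k S Y = 0) : euler k X Y = 0 := by
  induction hX with
  | zero Z hZ =>
    have h₁ : homDim k Z Y = 0 := (homDim_eq_zero_iff hP).2 fun f => hZ.eq_of_src f 0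
    have h₂ : homDim k Y Z = 0 := (homDim_eq_zero_iff hP).2 fun f => hZ.eq_of_tgt f 0
    simp [euler, h₁, h₂]
  | extension E hE _ h₃ ih =>
    rw [euler_add hP hE, ih, euler_congr h₃.some (Iso.refl Y), hY, add_zero]

/-- The endo-simple object underlying an iterated self-extension is unique. -/
theorem nonempty_iso (hP : IsPaired k C) {S' X : C} (hS : EndoSimple k S) (hS' : EndoSimple k S')
    (hX : ¬ IsZero X) (h : IteratedSelfExt S X) (h' : IteratedSelfExt S' X) :
    Nonempty (S ≅ S') := by
  have hne : 𝟙 X ≠ 0 := fun h => hX ((IsZero.iff_id_eq_zero X).2 h)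
  obtain ⟨a, ha⟩ := h.exists_hom_left _ hne
  obtain ⟨a', ha'⟩ := h'.exists_hom_right a ha
  obtain ⟨b, hb⟩ := h'.exists_hom_left _ hne
  obtain ⟨b', hb'⟩ := h.exists_hom_right b hb
  exact hS.nonempty_iso hP hS' a' ha' b' hb'

end IteratedSelfExt

end IteratedSelfExt

/-! ### Indecomposables are iterated self-extensions of endo-simples. -/

section Decomposition

variable {k : Type t} [Field k] {C : Type u} [Category.{v} C] [Abelian C] [Linear k C]

theorem homDim_add_le (hP : IsPaired k C) (Y Z : C) :
    homDim k Y Y + homDim k Z Z ≤ homDim k (Y ⊞ Z) (Y ⊞ Z) := by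
  have := hP.hom_finite Y Y
  have := hP.hom_finite Z Z
  have := hP.hom_finite (Y ⊞ Z) (Y ⊞ Z)
  let φ : (Y ⟶ Y) × (Z ⟶ Z) →ₗ[k] (Y ⊞ Z ⟶ Y ⊞ Z) :=
    { toFun := fun p => biprod.map p.1 p.2
      map_add' := fun p q => by ext <;> simp
      map_smul' := fun c p => by ext <;> simp }
  have hφ : Function.Injective φ := by
    intro p q h
    have h : biprod.map p.1 p.2 = biprod.map q.1 q.2 := h
    ext
    · simpa using congrArg (fun t => biprod.inl ≫ t ≫ biprod.fst) h
    · simpa using congrArg (fun t => biprod.inr ≫ t ≫ biprod.snd) h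
  have := LinearMap.finrank_le_finrank_of_injective hφ
  rwa [Module.finrank_prod] at this

/-- Induction along direct sum decompositions into indecomposable objects. -/
theorem decomposition_induction (hP : IsPaired k C) {P : C → Prop}
    (iso : ∀ X Y, (X ≅ Y) → P X → P Y) (zero : ∀ X, IsZero X → P X)
    (indec : ∀ X, Indecomposable X → P X) (biprod : ∀ X Y, P X → P Y → P (X ⊞ Y)) (X : C) :
    P X := by
  induction hn : homDim k X X using Nat.strong_induction_on generalizing X with
  | _ n ih =>
    by_cases h0 : IsZero X
    · exact zero X h0
    by_cases hX : Indecomposable X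
    · exact indec X hX
    · have : ∃ Y Z, ∃ e : X ≅ Y ⊞ Z, ¬ IsZero Y ∧ ¬ IsZero Z := by
        by_contra! hcon
        exact hX ⟨h0, fun Y Z e => or_iff_not_imp_left.2 fun h => hcon Y Z e h⟩
      obtain ⟨Y, Z, e, hY, hZ⟩ := this
      have h1 := homDim_add_le (k := k) hP Y Z
      rw [← homDim_congr e e, hn] at h1
      have pos : ∀ {W : C}, ¬ IsZero W → 0 < homDim k W W := fun {W} hW =>
        (homDim_pos_iff hP).2 ⟨𝟙 W, fun h => hW ((IsZero.iff_id_eq_zero W).2 h)⟩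
      have := pos hY
      have := pos hZ
      exact iso _ _ e.symm (biprod _ _ (ih _ (by omega) Y rfl) (ih _ (by omega) Z rfl))

theorem euler_biprod (hP : IsPaired k C) (X Y Z : C) :
    euler k (X ⊞ Y) Z = euler k X Z + euler k Y Z :=
  euler_add hP (shortExact_biprod X Y) Z

/-- If all indecomposable retracts of `K` are iterated self-extensions of endo-simple objects and
map nontrivially to `S`, then `K` has nonnegative Euler form against `S`, with equality only for
iterated self-extensions of `S`. -/
theorem euler_nonneg_of_retracts (hP : IsPaired k C) {S : C} (hS : EndoSimple k S) (K : C)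
    (h : ∀ (L : C) (i : L ⟶ K) (p : K ⟶ L), i ≫ p = 𝟙 L → Indecomposable L →
      (∃ S', EndoSimple k S' ∧ IteratedSelfExt S' L) ∧ ∃ f : L ⟶ S, f ≠ 0) :
    0 ≤ euler k K S ∧ (euler k K S = 0 → IteratedSelfExt S K) := by
  revert h
  refine decomposition_induction (k := k) hP (P := fun K =>
    (∀ (L : C) (i : L ⟶ K) (p : K ⟶ L), i ≫ p = 𝟙 L → Indecomposable L →
      (∃ S', EndoSimple k S' ∧ IteratedSelfExt S' L) ∧ ∃ f : L ⟶ S, f ≠ 0) →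
    0 ≤ euler k K S ∧ (euler k K S = 0 → IteratedSelfExt S K)) ?_ ?_ ?_ ?_ K
  · intro X Y e hX h
    rw [euler_congr e.symm (Iso.refl S)]
    obtain ⟨h₁, h₂⟩ := hX fun L i p hip hL => h L (i ≫ e.hom) (e.inv ≫ p) (by simpa using hip) hL
    exact ⟨h₁, fun h => (h₂ h).of_iso e⟩
  · intro X hX _
    have h0 := IteratedSelfExt.zero (S := S) X hX
    exact ⟨(h0.euler_eq_zero hP (euler_self S)).ge, fun _ => h0⟩
  · intro X hX h
    obtain ⟨⟨S', hS', hXS'⟩, f, hf⟩ := h X (𝟙 X) (𝟙 X) (by simp) hX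
    -- Maps in both directions between `X` and `S` identify `S'` with `S`, so the Euler form
    -- vanishes. With maps in one direction only, it is strictly positive.
    by_cases hSX : ∃ g : S ⟶ X, g ≠ 0
    · obtain ⟨g, hg⟩ := hSX
      obtain ⟨a, ha⟩ := hXS'.exists_hom_right g hg
      obtain ⟨b, hb⟩ := hXS'.exists_hom_left f hf
      obtain ⟨e⟩ := hS.nonempty_iso hP hS' a ha b hb
      have := hXS'.congr e.symm
      exact ⟨(this.euler_eq_zero hP (euler_self S)).ge, fun _ => this⟩
    · push Not at hSX
      have h₁ := (homDim_eq_zero_iff hP).2 hSX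
      have h₂ := (homDim_pos_iff hP).2 ⟨f, hf⟩
      unfold euler
      exact ⟨by omega, fun _ => by omega⟩
  · intro X Y hX hY h
    obtain ⟨h₁, h₂⟩ := hX fun L i p hip hL =>
      h L (i ≫ biprod.inl) (biprod.fst ≫ p) (by simpa using hip) hL
    obtain ⟨h₃, h₄⟩ := hY fun L i p hip hL =>
      h L (i ≫ biprod.inr) (biprod.snd ≫ p) (by simpa using hip) hL
    rw [euler_biprod hP]
    exact ⟨by omega, fun h => (h₂ (by omega)).biprod (h₄ (by omega))⟩

/-- Dual to `euler_nonneg_of_retracts`; used for cokernels. -/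
theorem euler_nonpos_of_retracts (hP : IsPaired k C) {S : C} (hS : EndoSimple k S) (K : C)
    (h : ∀ (L : C) (i : L ⟶ K) (p : K ⟶ L), i ≫ p = 𝟙 L → Indecomposable L →
      (∃ S', EndoSimple k S' ∧ IteratedSelfExt S' L) ∧ ∃ f : S ⟶ L, f ≠ 0) :
    euler k K S ≤ 0 ∧ (euler k K S = 0 → IteratedSelfExt S K) := by
  revert h
  refine decomposition_induction (k := k) hP (P := fun K =>
    (∀ (L : C) (i : L ⟶ K) (p : K ⟶ L), i ≫ p = 𝟙 L → Indecomposable L →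
      (∃ S', EndoSimple k S' ∧ IteratedSelfExt S' L) ∧ ∃ f : S ⟶ L, f ≠ 0) →
    euler k K S ≤ 0 ∧ (euler k K S = 0 → IteratedSelfExt S K)) ?_ ?_ ?_ ?_ K
  · intro X Y e hX h
    rw [euler_congr e.symm (Iso.refl S)]
    obtain ⟨h₁, h₂⟩ := hX fun L i p hip hL => h L (i ≫ e.hom) (e.inv ≫ p) (by simpa using hip) hL
    exact ⟨h₁, fun h => (h₂ h).of_iso e⟩
  · intro X hX _
    have h0 := IteratedSelfExt.zero (S := S) X hX
    exact ⟨(h0.euler_eq_zero hP (euler_self S)).le, fun _ => h0⟩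
  · intro X hX h
    obtain ⟨⟨S', hS', hXS'⟩, f, hf⟩ := h X (𝟙 X) (𝟙 X) (by simp) hX
    by_cases hSX : ∃ g : X ⟶ S, g ≠ 0
    · obtain ⟨g, hg⟩ := hSX
      obtain ⟨a, ha⟩ := hXS'.exists_hom_right f hf
      obtain ⟨b, hb⟩ := hXS'.exists_hom_left g hg
      obtain ⟨e⟩ := hS.nonempty_iso hP hS' a ha b hb
      have := hXS'.congr e.symm
      exact ⟨(this.euler_eq_zero hP (euler_self S)).le, fun _ => this⟩
    · push Not at hSX
      have h₁ := (homDim_eq_zero_iff hP).2 hSX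
      have h₂ := (homDim_pos_iff hP).2 ⟨f, hf⟩
      unfold euler
      exact ⟨by omega, fun _ => by omega⟩
  · intro X Y hX hY h
    obtain ⟨h₁, h₂⟩ := hX fun L i p hip hL =>
      h L (i ≫ biprod.inl) (biprod.fst ≫ p) (by simpa using hip) hL
    obtain ⟨h₃, h₄⟩ := hY fun L i p hip hL =>
      h L (i ≫ biprod.inr) (biprod.snd ≫ p) (by simpa using hip) hL
    rw [euler_biprod hP]
    exact ⟨by omega, fun h => (h₂ (by omega)).biprod (h₄ (by omega))⟩

theorem homDim_retract_le (hP : IsPaired k C) {K L : C} (i : L ⟶ K) (p : K ⟶ L)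
    (h : i ≫ p = 𝟙 L) : homDim k L L ≤ homDim k K K := by
  have : Mono i := mono_of_mono_fac h
  have : Epi p := epi_of_epi_fac h
  exact (homDim_le_of_mono hP i L).trans (homDim_le_of_epi hP p K)

/-- An indecomposable object which is not endo-simple has an endo-simple object which is at once
a quotient and a subobject. -/
theorem exists_endoSimple_image [IsAlgClosed k] (hP : IsPaired k C) {X : C} (hX : Indecomposable X)
    (hnX : ¬ EndoSimple k X) : ∃ (S : C) (q : X ⟶ S) (i : S ⟶ X), EndoSimple k S ∧ Epi q ∧ Mono i := by
  classical
  -- Images of non-invertible endomorphisms of `X` are candidates for `S`; one with `dim Hom(X, S)`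
  -- minimal is taken.
  have hex : ∃ n, ∃ (S : C) (q : X ⟶ S) (i : S ⟶ X), Epi q ∧ Mono i ∧ ¬ IsZero S ∧
      ¬ IsIso (q ≫ i) ∧ homDim k X S = n := by
    by_contra! hcon
    refine hnX (endoSimple_of_forall_isIso hP hX.1 fun f hf => ?_)
    by_contra hfi
    refine hcon _ (Limits.image f) (Limits.factorThruImage f) (Limits.image.ι f) inferInstance
      inferInstance (fun h0 => hf ?_) (by rwa [Limits.image.fac]) rfl
    rw [← Limits.image.fac f, h0.eq_of_tgt (Limits.factorThruImage f) 0, zero_comp]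
  obtain ⟨S, q, i, hq, hi, hS0, hqi, hn⟩ := Nat.find_spec hex
  have hmin := fun m => Nat.find_min' hex (m := m)
  rw [← hn] at hmin
  refine ⟨S, q, i, endoSimple_of_forall_isIso hP hS0 fun h hh => ?_, hq, hi⟩
  have hle := hmin (homDim k X (Limits.image h)) ⟨Limits.image h, q ≫ Limits.factorThruImage h,
    Limits.image.ι h ≫ i, epi_comp _ _, mono_comp _ _, fun h0 => hh ?_, fun hiso => hqi ?_, rfl⟩
  -- By minimality `Hom(X, image h) → Hom(X, S)` is bijective, so `q` factors through `image h` and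
  -- `h` is epi.
  · have := hP.hom_finite X (Limits.image h)
    have := hP.hom_finite X S
    have hinj : Function.Injective (Linear.rightComp k X (Limits.image.ι h)) :=
      fun a b hab => (cancel_mono (Limits.image.ι h)).1 hab
    have heq := le_antisymm (LinearMap.finrank_le_finrank_of_injective hinj) hle
    obtain ⟨r, hr⟩ := (LinearMap.injective_iff_surjective_of_finrank_eq_finrank heq).1 hinj q
    have : Epi (Limits.image.ι h) := epi_of_epi_fac hr
    have : Epi h := by rw [← Limits.image.fac h]; infer_instance
    exact isIso_of_epi_endo hP h
  · rw [← Limits.image.fac h, h0.eq_of_tgt (Limits.factorThruImage h) 0, zero_comp]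
  · have h1 : (q ≫ Limits.factorThruImage h) ≫ Limits.image.ι h ≫ i = q ≫ h ≫ i := by
      rw [Category.assoc, Limits.image.fac_assoc]
    rw [h1] at hiso
    have : Mono q := mono_of_mono q (h ≫ i)
    have : Epi i := by
      have : Epi ((q ≫ h) ≫ i) := by rw [Category.assoc]; infer_instance
      exact epi_of_epi (q ≫ h) i
    have := isIso_of_mono_of_epi q
    have := isIso_of_mono_of_epi i
    infer_instance

theorem homDim_lt_of_not_split (hP : IsPaired k C) {S : ShortComplex C} (hS : S.ShortExact)
    (h₃ : ¬ IsZero S.X₃) : homDim k S.X₂ S.X₁ < homDim k S.X₂ S.X₂ := by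
  rw [homDim_eq_add_range_right hP hS S.X₂]
  refine Nat.lt_add_of_pos_right (Nat.pos_of_ne_zero fun h0 => h₃ ?_)
  have := hP.hom_finite S.X₂ S.X₃
  rw [Submodule.finrank_eq_zero, LinearMap.range_eq_bot] at h0
  have := hS.epi_g
  have h1 : 𝟙 S.X₂ ≫ S.g = 0 := LinearMap.congr_fun h0 (𝟙 S.X₂)
  rw [IsZero.iff_id_eq_zero, ← cancel_epi S.g, comp_zero, Category.comp_id]
  simpa using h1

theorem homDim_lt_of_not_split' (hP : IsPaired k C) {S : ShortComplex C} (hS : S.ShortExact)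
    (h₁ : ¬ IsZero S.X₁) : homDim k S.X₃ S.X₂ < homDim k S.X₂ S.X₂ := by
  rw [homDim_eq_add_range_left hP hS S.X₂]
  refine Nat.lt_add_of_pos_right (Nat.pos_of_ne_zero fun h0 => h₁ ?_)
  have := hP.hom_finite S.X₁ S.X₂
  rw [Submodule.finrank_eq_zero, LinearMap.range_eq_bot] at h0
  have := hS.mono_f
  have h1 : S.f ≫ 𝟙 S.X₂ = 0 := LinearMap.congr_fun h0 (𝟙 S.X₂)
  rw [IsZero.iff_id_eq_zero, ← cancel_mono S.f, zero_comp, Category.id_comp]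
  simpa using h1

/-- The sign of `euler k X S` selects the kernel of `q` or the cokernel of `i` for the induction.
Additivity gives this object the same Euler form as `X`, while its summands force the opposite sign;
so the form is zero and all summands lie in the class of `S`. -/
theorem exists_endoSimple [IsAlgClosed k] (hP : IsPaired k C) (X : C) (hX : Indecomposable X) :
    ∃ S : C, EndoSimple k S ∧ IteratedSelfExt S X := by
  induction hn : homDim k X X using Nat.strong_induction_on generalizing X with
  | _ n ih =>
    by_cases hES : EndoSimple k X
    · exact ⟨X, hES, .self X⟩
    obtain ⟨S, q, i, hS, hq, hi⟩ := exists_endoSimple_image hP hX hES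
    refine ⟨S, hS, ?_⟩
    have hSE := shortExact_kernel q
    have hSE' := shortExact_cokernel i
    have iqne : ¬ IsIso q := fun _ => hES (hS.of_iso (asIso q).symm)
    have iine : ¬ IsIso i := fun _ => hES (hS.of_iso (asIso i))
    rcases le_total (euler k X S) 0 with hle | hle
    · have h1 := euler_add hP hSE S
      rw [euler_self, add_zero] at h1
      change euler k X S = euler k (kernel q) S at h1
      have h2 := homDim_lt_of_not_split hP hSE hS.not_isZero
      have h3 := homDim_left_le hP hSE (kernel q)
      change homDim k X (kernel q) < homDim k X X at h2
      change homDim k (kernel q) (kernel q) + homDim k S (kernel q) ≤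
        homDim k X (kernel q) + homDim k (kernel q) S at h3
      -- As `euler k (kernel q) S ≤ 0`, the terms with `S` in `h3` can be dropped, leaving `dim End
      -- (kernel q) ≤ dim Hom(X, kernel q) < n`.
      have h4 : homDim k (kernel q) (kernel q) < n := by unfold euler at *; omega
      obtain ⟨h5, h6⟩ := euler_nonneg_of_retracts hP hS (kernel q) fun L a p hap hL => by
        refine ⟨ih _ ((homDim_retract_le hP a p hap).trans_lt h4) L hL rfl, ?_⟩
        -- Without maps `L ⟶ S` the projection `p` extends to `X`, so `L` is a nonzero retract of
        -- `X`; then `kernel.ι q` is epi and `q = 0`.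
        by_contra! hcon
        obtain ⟨l, hl⟩ := hP.exists_pairing _ hSE
        obtain ⟨r, hr⟩ := (hl.desc_iff p).2 fun u => by rw [hcon u, comp_zero, map_zero]
        change kernel.ι q ≫ r = p at hr
        obtain ⟨ha, -⟩ := hX.isIso_of_retract hL.1 (a ≫ kernel.ι q) r (by rw [Category.assoc, hr, hap])
        have : Epi (kernel.ι q) := epi_of_epi a (kernel.ι q)
        have hq0 : q = 0 := by rw [← cancel_epi (kernel.ι q), kernel.condition, comp_zero]
        exact hS.id_ne_zero (by rw [← cancel_epi q, Category.comp_id, hq0, comp_zero])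
      exact .extension _ hSE (h6 (by omega)) ⟨Iso.refl _⟩
    · have h1 := euler_add hP hSE' S
      change euler k X S = euler k S S + euler k (cokernel i) S at h1
      rw [euler_self, zero_add] at h1
      have h2 := homDim_lt_of_not_split' hP hSE' hS.not_isZero
      have h3 := homDim_right_le hP hSE' (cokernel i)
      change homDim k (cokernel i) X < homDim k X X at h2
      change homDim k (cokernel i) (cokernel i) + homDim k (cokernel i) S ≤
        homDim k (cokernel i) X + homDim k S (cokernel i) at h3
      have h4 : homDim k (cokernel i) (cokernel i) < n := by unfold euler at *; omega
      obtain ⟨h5, h6⟩ := euler_nonpos_of_retracts hP hS (cokernel i) fun L a p hap hL => by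
        refine ⟨ih _ ((homDim_retract_le hP a p hap).trans_lt h4) L hL rfl, ?_⟩
        by_contra! hcon
        obtain ⟨l, hl⟩ := hP.exists_pairing _ hSE'
        obtain ⟨r, hr⟩ := (hl.lift_iff a).2 fun u => by rw [hcon u, zero_comp, map_zero]
        change r ≫ cokernel.π i = a at hr
        obtain ⟨-, ha⟩ := hX.isIso_of_retract hL.1 r (cokernel.π i ≫ p)
          (by rw [← Category.assoc, hr, hap])
        have : Mono (cokernel.π i) := mono_of_mono (cokernel.π i) p
        have hi0 : i = 0 := by rw [← cancel_mono (cokernel.π i), cokernel.condition, zero_comp]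
        exact hS.id_ne_zero (by rw [← cancel_mono i, Category.id_comp, hi0, zero_comp])
      exact .of_shortExact hSE' (.self S) (h6 (by omega))

/-- `L` belongs to some endo-simple `S'`; its inclusion and projection yield nonzero maps `S' ⟶ S`
and `S ⟶ S'`. -/
theorem IteratedSelfExt.of_retract [IsAlgClosed k] (hP : IsPaired k C) {S : C}
    (hS : EndoSimple k S) {X L : C} (hX : IteratedSelfExt S X) (hL : Indecomposable L) (i : L ⟶ X)
    (p : X ⟶ L) (hip : i ≫ p = 𝟙 L) : IteratedSelfExt S L := by
  obtain ⟨S', hS', hLS'⟩ := exists_endoSimple hP L hL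
  have hne : 𝟙 L ≠ 0 := fun h => hL.1 ((IsZero.iff_id_eq_zero L).2 h)
  have hi : i ≠ 0 := fun h => hne (by rw [← hip, h, zero_comp])
  have hp : p ≠ 0 := fun h => hne (by rw [← hip, h, comp_zero])
  obtain ⟨a, ha⟩ := hX.exists_hom_right i hi
  obtain ⟨a', ha'⟩ := hLS'.exists_hom_left a ha
  obtain ⟨b, hb⟩ := hX.exists_hom_left p hp
  obtain ⟨b', hb'⟩ := hLS'.exists_hom_right b hb
  exact hLS'.congr (hS'.nonempty_iso hP hS a' ha' b' hb').some

end Decomposition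

/-! ### Cycles of nonzero morphisms. -/

section Cycles

variable {k : Type t} [Field k] {C : Type u} [Category.{v} C] [Abelian C] [Linear k C]

/-- The endo-simple objects underlying the members of a cycle of nonzero morphisms agree. -/
theorem nonempty_iso_of_cycle (hP : IsPaired k C) (n : ℕ) (X S : Fin (n + 1) → C)
    (f : ∀ i, X i ⟶ X (i + 1)) (hf : ∀ i, f i ≠ 0) (hS : ∀ i, EndoSimple k (S i))
    (hX : ∀ i, IteratedSelfExt (S i) (X i)) (i : Fin (n + 1)) : Nonempty (S i ≅ S 0) := by
  have hR : ∀ i, HomRel k (S i) (S (i + 1)) := fun i => by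
    obtain ⟨a, ha⟩ := (hX i).exists_hom_left (f i) (hf i)
    obtain ⟨b, hb⟩ := (hX (i + 1)).exists_hom_right a ha
    exact ⟨hS i, hS (i + 1), b, hb⟩
  have hT : ∀ (m : ℕ) (i : Fin (n + 1)),
      Relation.TransGen (HomRel k) (S i) (S (i + (m + 1) • (1 : Fin (n + 1)))) := by
    intro m i
    induction m with
    | zero => simpa using Relation.TransGen.single (hR i)
    | succ m ih =>
      refine ih.tail ?_
      have := hR (i + (m + 1) • (1 : Fin (n + 1)))
      rwa [add_assoc, ← succ_nsmul] at this
  have hiso : ∀ i, Nonempty (S i ≅ S (i + 1)) := fun i => by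
    refine (hR i).nonempty_iso_of_transGen hP ?_
    -- From `i + 1` back to `i` in `2 * n + 1` steps, completing two laps; one lap would leave an
    -- empty path when `n = 0`.
    have := hT (2 * n) (i + 1)
    have h0 : i + 1 + (2 * n + 1) • (1 : Fin (n + 1)) = i := by
      have h1 : (n + 1) • (1 : Fin (n + 1)) = 0 := by
        simpa using card_nsmul_eq_zero (x := (1 : Fin (n + 1)))
      have h2 : (1 : Fin (n + 1)) + (2 * n + 1) • (1 : Fin (n + 1)) = 0 := by
        rw [← succ_nsmul', show 2 * n + 1 + 1 = (n + 1) + (n + 1) by ring, add_nsmul, h1, add_zero]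
      rw [add_assoc, h2, add_zero]
    rwa [h0] at this
  induction i using Fin.induction with
  | zero => exact ⟨Iso.refl _⟩
  | succ i ih =>
    obtain ⟨e⟩ := ih
    obtain ⟨e'⟩ := hiso i.castSucc
    rw [Fin.coeSucc_eq_succ] at e'
    exact ⟨e'.symm ≪≫ e⟩

end Cycles

/-! ### The tower of extensions over an endo-simple object. -/

section Tube

variable (k : Type t) [Field k] {C : Type u} [Category.{v} C] [Abelian C] [Linear k C]

/-- A tower `⋯ ⟶ T 2 ⟶ T 1 ⟶ T 0 ≅ S` of nonsplit extensions with kernel `S`. -/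
structure Tower (S : C) where
  T : ℕ → C
  s : ∀ n, S ⟶ T n
  π : ∀ n, T (n + 1) ⟶ T n
  isIso_s : IsIso (s 0)
  w : ∀ n, s (n + 1) ≫ π n = 0
  l : ∀ n, (S ⟶ T n) →ₗ[k] k
  pairing : ∀ n, IsPairing (ShortComplex.mk (s (n + 1)) (π n) (w n)) (l n)
  l_s : ∀ n, l n (s n) ≠ 0

variable {k}

theorem exists_tower_step (hP : IsPaired k C) {S : C} (hS : EndoSimple k S)
    (A : Σ X : C, {s : S ⟶ X // s ≠ 0}) :
    ∃ (B : Σ X : C, {s : S ⟶ X // s ≠ 0}) (π : B.1 ⟶ A.1) (w : B.2.1 ≫ π = 0)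
      (l : (S ⟶ A.1) →ₗ[k] k), IsPairing (ShortComplex.mk B.2.1 π w) l ∧ l A.2.1 ≠ 0 := by
  obtain ⟨X, s, hs⟩ := A
  obtain ⟨l, hl⟩ : ∃ l : Module.Dual k (S ⟶ X), l s ≠ 0 := by
    by_contra! h
    exact hs ((Module.forall_dual_apply_eq_zero_iff k s).1 h)
  obtain ⟨E, f, g, zero, hE⟩ := hP.exists_shortComplex S X l
  have := hE.shortExact.mono_f
  refine ⟨⟨E, f, fun h => hS.id_ne_zero ?_⟩, g, zero, l, hE, hl⟩
  have : Mono f := hE.shortExact.mono_f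
  rw [← cancel_mono f, Category.id_comp, zero_comp, h]

theorem nonempty_tower (hP : IsPaired k C) {S : C} (hS : EndoSimple k S) :
    Nonempty (Tower k S) := by
  choose B π w l hl hs using exists_tower_step hP hS
  let A : ℕ → Σ X : C, {s : S ⟶ X // s ≠ 0} :=
    fun n => Nat.rec ⟨S, 𝟙 S, hS.id_ne_zero⟩ (fun _ => B) n
  exact ⟨{
    T := fun n => (A n).1
    s := fun n => (A n).2.1
    π := fun n => π (A n)
    isIso_s := inferInstanceAs (IsIso (𝟙 S))
    w := fun n => w (A n)
    l := fun n => l (A n)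
    pairing := fun n => hl (A n)
    l_s := fun n => hs (A n) }⟩

namespace Tower

attribute [instance] isIso_s

attribute [simp] w

variable {S : C} (τ : Tower k S)

@[simp]
theorem w_assoc (n : ℕ) {Z : C} (h : τ.T n ⟶ Z) : τ.s (n + 1) ≫ τ.π n ≫ h = 0 := by
  rw [← Category.assoc, τ.w, zero_comp]

instance mono_s (n : ℕ) : Mono (τ.s n) := by
  cases n with
  | zero => infer_instance
  | succ n => exact (τ.pairing n).shortExact.mono_f

instance epi_π (n : ℕ) : Epi (τ.π n) := (τ.pairing n).shortExact.epi_g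

/-- The projection onto the top. -/
def top : ∀ n, τ.T n ⟶ S
  | 0 => inv (τ.s 0)
  | n + 1 => τ.π n ≫ top n

theorem top_zero : τ.top 0 = inv (τ.s 0) := rfl

theorem top_succ (n : ℕ) : τ.top (n + 1) = τ.π n ≫ τ.top n := rfl

instance epi_top : ∀ n, Epi (τ.top n)
  | 0 => inferInstanceAs (Epi (inv (τ.s 0)))
  | n + 1 => by
    have := epi_top n
    exact epi_comp _ _

theorem exists_of_π_eq_zero (n : ℕ) {X : C} (f : X ⟶ τ.T (n + 1)) (h : f ≫ τ.π n = 0) :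
    ∃ g : X ⟶ S, g ≫ τ.s (n + 1) = f :=
  ⟨(τ.pairing n).shortExact.exact.lift f h, (τ.pairing n).shortExact.exact.lift_f f h⟩

theorem exists_of_s_eq_zero (n : ℕ) {X : C} (f : τ.T (n + 1) ⟶ X) (h : τ.s (n + 1) ≫ f = 0) :
    ∃ g : τ.T n ⟶ X, τ.π n ≫ g = f :=
  ⟨(τ.pairing n).shortExact.exact.desc f h, (τ.pairing n).shortExact.exact.g_desc f h⟩

theorem iteratedSelfExt (n : ℕ) : IteratedSelfExt S (τ.T n) := by
  induction n with
  | zero => exact (IteratedSelfExt.self S).of_iso (asIso (τ.s 0))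
  | succ n ih => exact .of_shortExact (τ.pairing n).shortExact (.self S) ih

variable (hS : EndoSimple k S)

include hS

theorem s_ne_zero (n : ℕ) : τ.s n ≠ 0 := fun h =>
  hS.id_ne_zero (by rw [← cancel_mono (τ.s n), Category.id_comp, zero_comp, h])

theorem top_ne_zero (n : ℕ) : τ.top n ≠ 0 := fun h =>
  hS.id_ne_zero (by rw [← cancel_epi (τ.top n), Category.comp_id, comp_zero, h])

/-- A map to `T (n + 1)` projects to some `c • s n`. Since this lifts, `l n` kills it, so `c = 0` by
`l_s` and the map factors through the new socle. -/
theorem eq_smul_s (n : ℕ) (f : S ⟶ τ.T n) : ∃ c : k, f = c • τ.s n := by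
  induction n with
  | zero =>
    obtain ⟨c, hc⟩ := (endoSimple_iff.1 hS).2 (f ≫ inv (τ.s 0))
    refine ⟨c, ?_⟩
    rw [IsIso.comp_inv_eq] at hc
    simpa using hc
  | succ n ih =>
    obtain ⟨c, hc⟩ := ih (f ≫ τ.π n)
    have h := ((τ.pairing n).lift_iff (f ≫ τ.π n)).1 ⟨f, rfl⟩ (𝟙 S)
    rw [Category.id_comp, hc, map_smul, smul_eq_mul] at h
    have hc0 : c = 0 := (mul_eq_zero.1 h).resolve_right (τ.l_s n)
    rw [hc0, zero_smul] at hc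
    obtain ⟨g, rfl⟩ := τ.exists_of_π_eq_zero n f hc
    obtain ⟨d, rfl⟩ := (endoSimple_iff.1 hS).2 g
    exact ⟨d, by simp⟩

theorem comp_π_eq_zero (n : ℕ) (f : S ⟶ τ.T (n + 1)) : f ≫ τ.π n = 0 := by
  obtain ⟨c, rfl⟩ := τ.eq_smul_s hS _ f
  simp

theorem not_isZero (n : ℕ) : ¬ IsZero (τ.T n) := fun h => τ.s_ne_zero hS n (h.eq_of_tgt _ _)

variable (hP : IsPaired k C)

include hP

/-- The Euler form vanishes within the class of `S`, so `Hom(T n, S)` inherits dimension one from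
`Hom(S, T n)`. -/
theorem eq_smul_top (n : ℕ) (f : τ.T n ⟶ S) : ∃ c : k, f = c • τ.top n := by
  have h₁ : homDim k S (τ.T n) = 1 := by
    refine finrank_eq_one (τ.s n) (τ.s_ne_zero hS n) fun f => ?_
    obtain ⟨c, hc⟩ := τ.eq_smul_s hS n f
    exact ⟨c, hc.symm⟩
  have h₂ := (τ.iteratedSelfExt n).euler_eq_zero hP (euler_self (k := k) S)
  have h₃ : homDim k (τ.T n) S = 1 := by unfold euler at h₂; omega
  obtain ⟨c, hc⟩ := exists_smul_eq_of_finrank_eq_one h₃ (τ.top_ne_zero hS n) f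
  exact ⟨c, hc.symm⟩

/-- After pulling back along `π`, morphisms lift along epimorphisms with kernel `S`. -/
theorem exists_lift (n : ℕ) {E X : C} (j : S ⟶ E) (p : E ⟶ X) (z : j ≫ p = 0)
    (hE : (ShortComplex.mk j p z).ShortExact) (g : τ.T n ⟶ X) :
    ∃ h : τ.T (n + 1) ⟶ E, h ≫ p = τ.π n ≫ g := by
  obtain ⟨l, hl⟩ := hP.exists_pairing _ hE
  refine (hl.lift_iff (τ.π n ≫ g)).2 fun u => ?_
  rw [← Category.assoc, τ.comp_π_eq_zero hS n u, zero_comp, map_zero]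

omit hS hP

end Tower

/-- A tower together with compatible embeddings of each of its members into the next. -/
structure Ladder (k : Type t) [Field k] {C : Type u} [Category.{v} C] [Abelian C] [Linear k C]
    (S : C) extends Tower k S where
  ι : ∀ n, T n ⟶ T (n + 1)
  s_ι_zero : s 0 ≫ ι 0 = s 1
  ι_π_succ : ∀ n, ι (n + 1) ≫ π (n + 1) = π n ≫ ι n

theorem nonempty_ladder (hP : IsPaired k C) {S : C} (hS : EndoSimple k S) :
    Nonempty (Ladder k S) := by
  obtain ⟨τ⟩ := nonempty_tower hP hS
  choose f hf using fun n (g : τ.T n ⟶ τ.T (n + 1)) =>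
    τ.exists_lift hS hP n _ _ _ (τ.pairing (n + 1)).shortExact g
  let ι : ∀ n, τ.T n ⟶ τ.T (n + 1) := fun n => Nat.rec (inv (τ.s 0) ≫ τ.s 1) (fun n g => f n g) n
  exact ⟨{ τ with
    ι := ι
    s_ι_zero := IsIso.hom_inv_id_assoc (τ.s 0) (τ.s 1)
    ι_π_succ := fun n => hf n (ι n) }⟩

end Tube

/-! ### Morphisms between members of the tower. -/

namespace Ladder

variable {k : Type t} [Field k] {C : Type u} [Category.{v} C] [Abelian C] [Linear k C]
  {S : C} (τ : Ladder k S)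

/-- The nilpotent endomorphism of a member of the tower. -/
def t (n : ℕ) : End (τ.T n) := τ.ι n ≫ τ.π n

theorem t_def (n : ℕ) : (τ.t n : τ.T n ⟶ τ.T n) = τ.ι n ≫ τ.π n := rfl

theorem t_zero : (τ.t 0 : τ.T 0 ⟶ τ.T 0) = 0 := by
  rw [t_def, ← cancel_epi (τ.s 0), reassoc_of% τ.s_ι_zero, τ.w, comp_zero]

theorem t_succ (n : ℕ) : (τ.t (n + 1) : τ.T (n + 1) ⟶ τ.T (n + 1)) = τ.π n ≫ τ.ι n :=
  τ.ι_π_succ n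

/-- The action of polynomials in the nilpotent endomorphism. -/
def ev (n : ℕ) (p : Polynomial k) : τ.T n ⟶ τ.T n := (Polynomial.aeval (τ.t n) p : End (τ.T n))

theorem ev_mul (n : ℕ) (p q : Polynomial k) : τ.ev n (p * q) = τ.ev n p ≫ τ.ev n q := by
  rw [mul_comm]
  exact map_mul (Polynomial.aeval (τ.t n)) q p

theorem ev_add (n : ℕ) (p q : Polynomial k) : τ.ev n (p + q) = τ.ev n p + τ.ev n q :=
  map_add (Polynomial.aeval (τ.t n)) p q

theorem ev_sub (n : ℕ) (p q : Polynomial k) : τ.ev n (p - q) = τ.ev n p - τ.ev n q :=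
  map_sub (Polynomial.aeval (τ.t n)) p q

theorem ev_zero (n : ℕ) : τ.ev n 0 = 0 := map_zero (Polynomial.aeval (τ.t n))

theorem ev_one (n : ℕ) : τ.ev n 1 = 𝟙 _ := map_one (Polynomial.aeval (τ.t n))

theorem ev_smul (n : ℕ) (c : k) (p : Polynomial k) : τ.ev n (c • p) = c • τ.ev n p :=
  map_smul (Polynomial.aeval (τ.t n)) c p

theorem ev_C (n : ℕ) (c : k) : τ.ev n (Polynomial.C c) = c • 𝟙 _ := by
  rw [← mul_one (Polynomial.C c), ← Polynomial.smul_eq_C_mul, ev_smul, ev_one]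

theorem ev_X (n : ℕ) : τ.ev n Polynomial.X = τ.t n := Polynomial.aeval_X (τ.t n)

theorem ev_X_pow_succ (n m : ℕ) :
    τ.ev n (Polynomial.X ^ (m + 1)) = τ.t n ≫ τ.ev n (Polynomial.X ^ m) := by
  rw [pow_succ', ev_mul, ev_X]

theorem ev_π (n : ℕ) (p : Polynomial k) : τ.ev (n + 1) p ≫ τ.π n = τ.π n ≫ τ.ev n p := by
  induction p using Polynomial.induction_on with
  | C a => simp [ev_C]
  | add p q hp hq => simp [ev_add, hp, hq]
  | monomial m a h =>
    rw [pow_succ, ← mul_assoc, ev_mul, ev_mul τ n, ev_X, ev_X, t_succ, t_def, Category.assoc,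
      Category.assoc, reassoc_of% h]

theorem ι_ev (n : ℕ) (p : Polynomial k) : τ.ι n ≫ τ.ev (n + 1) p = τ.ev n p ≫ τ.ι n := by
  induction p using Polynomial.induction_on with
  | C a => simp [ev_C]
  | add p q hp hq => simp [ev_add, hp, hq]
  | monomial m a h =>
    rw [pow_succ, ← mul_assoc, ev_mul, ev_mul τ n, ev_X, ev_X, t_succ, t_def, Category.assoc,
      Category.assoc, reassoc_of% h]

theorem s_t (n : ℕ) : τ.s n ≫ τ.t n = 0 := by
  cases n with
  | zero => rw [t_zero, comp_zero]
  | succ n => rw [t_succ, Tower.w_assoc]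

theorem t_top (n : ℕ) : (τ.t n : τ.T n ⟶ τ.T n) ≫ τ.top n = 0 := by
  induction n with
  | zero => rw [t_zero, zero_comp]
  | succ n ih =>
    rw [t_succ, Tower.top_succ, Category.assoc, ← Category.assoc (τ.ι n), ← t_def, ih, comp_zero]

theorem ι_top (n : ℕ) : τ.ι n ≫ τ.top (n + 1) = 0 := by
  rw [Tower.top_succ, ← Category.assoc, ← t_def, t_top]

theorem s_ev (n : ℕ) (p : Polynomial k) : τ.s n ≫ τ.ev n p = p.coeff 0 • τ.s n := by
  conv_lhs => rw [← Polynomial.divX_mul_X_add p]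
  rw [ev_add, mul_comm, ev_mul, ev_X, ev_C, Preadditive.comp_add, reassoc_of% τ.s_t, zero_comp,
    zero_add, Linear.comp_smul, Category.comp_id]

theorem ev_top (n : ℕ) (p : Polynomial k) : τ.ev n p ≫ τ.top n = p.coeff 0 • τ.top n := by
  conv_lhs => rw [← Polynomial.divX_mul_X_add p]
  rw [ev_add, ev_mul, ev_X, ev_C, Preadditive.add_comp, Category.assoc, t_top, comp_zero,
    zero_add, Linear.smul_comp, Category.id_comp]

/-- The projection from a member of the tower to a lower one. -/
def proj {m n : ℕ} (h : n ≤ m) : τ.T m ⟶ τ.T n := (Functor.ofOpSequence τ.π).map (homOfLE h).op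

theorem proj_refl (n : ℕ) : τ.proj (le_refl n) = 𝟙 _ :=
  CategoryTheory.Functor.map_id (Functor.ofOpSequence τ.π) _

theorem proj_comp {l m n : ℕ} (h : n ≤ m) (h' : m ≤ l) :
    τ.proj h' ≫ τ.proj h = τ.proj (h.trans h') :=
  ((Functor.ofOpSequence τ.π).map_comp (homOfLE h').op (homOfLE h).op).symm

theorem proj_self_succ (n : ℕ) : τ.proj (Nat.le_add_right n 1) = τ.π n :=
  Functor.ofOpSequence_map_homOfLE_succ τ.π n

theorem proj_succ {m n : ℕ} (h : n ≤ m) (h' : n ≤ m + 1) : τ.proj h' = τ.π m ≫ τ.proj h := by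
  rw [← proj_self_succ, proj_comp]

theorem proj_π {m n : ℕ} (h : n ≤ m) (h' : n + 1 ≤ m) : τ.proj h' ≫ τ.π n = τ.proj h := by
  rw [← proj_self_succ, proj_comp]

theorem ev_proj {m n : ℕ} (h : n ≤ m) (p : Polynomial k) :
    τ.ev m p ≫ τ.proj h = τ.proj h ≫ τ.ev n p := by
  induction m, h using Nat.le_induction with
  | base => simp [proj_refl]
  | succ m h ih => rw [τ.proj_succ h, ← Category.assoc, ev_π, Category.assoc, ih, Category.assoc]

theorem top_eq_proj {m n : ℕ} (h : n ≤ m) : τ.top m = τ.proj h ≫ τ.top n := by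
  induction m, h using Nat.le_induction with
  | base => simp [proj_refl]
  | succ m h ih => rw [τ.proj_succ h, Category.assoc, ← ih, Tower.top_succ]

instance epi_proj {m n : ℕ} (h : n ≤ m) : Epi (τ.proj h) := by
  induction m, h using Nat.le_induction with
  | base => rw [proj_refl]; infer_instance
  | succ m h ih => rw [τ.proj_succ h]; exact epi_comp _ _

variable (hS : EndoSimple k S)

include hS

/-- If `ι (n + 1)` killed the socle, it would factor through `π n` and provide a lift of `ι n` along
`π (n + 1)`. But maps from `S` to `T (n + 2)` die under `π (n + 1)`, while `s n ≫ ι n` is nonzero.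
-/
theorem s_ι (n : ℕ) : ∃ c : k, c ≠ 0 ∧ τ.s n ≫ τ.ι n = c • τ.s (n + 1) := by
  induction n with
  | zero => exact ⟨1, one_ne_zero, by rw [τ.s_ι_zero, one_smul]⟩
  | succ n ih =>
    obtain ⟨c, hc⟩ := τ.eq_smul_s hS _ (τ.s (n + 1) ≫ τ.ι (n + 1))
    refine ⟨c, ?_, hc⟩
    rintro rfl
    rw [zero_smul] at hc
    obtain ⟨j, hj⟩ := τ.exists_of_s_eq_zero n _ hc
    have h1 : j ≫ τ.π (n + 1) = τ.ι n := by
      rw [← cancel_epi (τ.π n), reassoc_of% hj, τ.ι_π_succ]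
    obtain ⟨d, hd, h2⟩ := ih
    have h3 := τ.comp_π_eq_zero hS (n + 1) (τ.s n ≫ j)
    rw [Category.assoc, h1, h2] at h3
    exact (smul_ne_zero hd (τ.s_ne_zero hS (n + 1))) h3

/-- The last nonzero power of the nilpotent endomorphism carries the top onto the socle; the next
power vanishes. -/
theorem ev_X_pow_self (n : ℕ) :
    ∃ c : k, c ≠ 0 ∧ τ.ev n (Polynomial.X ^ n) = c • (τ.top n ≫ τ.s n) := by
  induction n with
  | zero => exact ⟨1, one_ne_zero, by rw [pow_zero, ev_one, Tower.top_zero, one_smul,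
      IsIso.inv_hom_id]⟩
  | succ n ih =>
    obtain ⟨c, hc, h⟩ := ih
    obtain ⟨d, hd, h'⟩ := τ.s_ι hS n
    refine ⟨c * d, mul_ne_zero hc hd, ?_⟩
    rw [ev_X_pow_succ, t_succ, Category.assoc, ι_ev, h, Tower.top_succ]
    simp [h', smul_smul]

theorem ev_X_pow_of_lt {m n : ℕ} (h : n < m) : τ.ev n (Polynomial.X ^ m) = 0 := by
  obtain ⟨c, -, hc⟩ := τ.ev_X_pow_self hS n
  obtain ⟨d, rfl⟩ := Nat.exists_eq_add_of_lt h
  rw [show n + d + 1 = (d + 1) + n by ring, pow_add, ev_mul, hc, pow_succ, ev_mul, ev_X,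
    Category.assoc, Linear.comp_smul, ← Category.assoc (τ.t n), t_top, zero_comp, smul_zero,
    comp_zero]

theorem isIso_ev (n : ℕ) (p : Polynomial k) (hp : p.coeff 0 ≠ 0) : IsIso (τ.ev n p) := by
  have hX : ¬ Polynomial.X ∣ p := fun h => hp (Polynomial.X_dvd_iff.1 h)
  obtain ⟨a, b, hab⟩ : IsCoprime p (Polynomial.X ^ (n + 1)) :=
    (((Polynomial.irreducible_X.coprime_iff_not_dvd).2 hX).pow_left).symm
  have h1 := congrArg (τ.ev n) hab
  rw [ev_add, ev_mul τ n b, τ.ev_X_pow_of_lt hS (Nat.lt_succ_self n), comp_zero, add_zero,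
    ev_one] at h1
  refine ⟨τ.ev n a, ?_, ?_⟩
  · rw [← ev_mul, mul_comm, h1]
  · rw [← ev_mul, h1]

/-- These are the sequences dual to the defining ones of the tower. In the inductive step a map
killed by the top comes from `ι` modulo the socle, and the socle lies in the image of `ι` by `s_ι`.
-/
theorem shortExact_ι_top (n : ℕ) :
    (ShortComplex.mk (τ.ι n) (τ.top (n + 1)) (τ.ι_top n)).ShortExact := by
  induction n with
  | zero =>
    have h1 : τ.ι 0 = inv (τ.s 0) ≫ τ.s 1 := (IsIso.eq_inv_comp _).2 τ.s_ι_zero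
    refine ShortComplex.shortExact_of_iso ?_ (τ.pairing 0).shortExact
    exact ShortComplex.isoMk (asIso (τ.s 0)) (Iso.refl _) (asIso (inv (τ.s 0)))
      (by simp [τ.s_ι_zero]) (by simp [Tower.top_succ, Tower.top_zero])
  | succ n ih =>
    obtain ⟨c, hc, h⟩ := τ.s_ι hS (n + 1)
    have hι : Mono (τ.ι n) := ih.mono_f
    refine @ShortComplex.ShortExact.mk _ _ _ _ ?_ ?_ (τ.epi_top _)
    · rw [ShortComplex.exact_iff_exact_up_to_refinements]
      intro A x hx
      change x ≫ τ.π (n + 1) ≫ τ.top (n + 1) = 0 at hx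
      rw [← Category.assoc] at hx
      let y : A ⟶ τ.T n := ih.exact.lift (x ≫ τ.π (n + 1)) hx
      have hy : y ≫ τ.ι n = x ≫ τ.π (n + 1) := ih.exact.lift_f _ hx
      have h2 : (pullback.fst y (τ.π n) ≫ x - pullback.snd y (τ.π n) ≫ τ.ι (n + 1)) ≫
          τ.π (n + 1) = 0 := by
        rw [Preadditive.sub_comp, Category.assoc, Category.assoc, τ.ι_π_succ, ← hy,
          pullback.condition_assoc, sub_self]
      obtain ⟨z, hz⟩ := τ.exists_of_π_eq_zero _ _ h2
      refine ⟨pullback y (τ.π n), pullback.fst y (τ.π n), inferInstance,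
        pullback.snd y (τ.π n) + c⁻¹ • z ≫ τ.s (n + 1), ?_⟩
      change _ = _ ≫ τ.ι (n + 1)
      rw [Preadditive.add_comp, Linear.smul_comp, Category.assoc, h, Linear.comp_smul, smul_smul,
        inv_mul_cancel₀ hc, one_smul, hz]
      abel
    · refine Preadditive.mono_of_cancel_zero _ fun {A} x hx => ?_
      change A ⟶ τ.T (n + 1) at x
      change x ≫ τ.ι (n + 1) = 0 at hx
      have h1 : x ≫ τ.π n = 0 := by
        rw [← cancel_mono (τ.ι n), zero_comp, Category.assoc, ← τ.ι_π_succ, reassoc_of% hx,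
          zero_comp]
      obtain ⟨y, rfl⟩ := τ.exists_of_π_eq_zero _ _ h1
      rw [Category.assoc, h, Linear.comp_smul, smul_eq_zero_iff_right hc] at hx
      rw [(cancel_mono (τ.s (n + 2))).1 (hx.trans zero_comp.symm), zero_comp]

/-- Members of the tower only admit, up to bounded height, morphisms that are nonzero on the socle
into a given iterated self-extension of `S`. -/
theorem exists_bound (hP : IsPaired k C) {X : C} (hX : IteratedSelfExt S X) :
    ∃ N, ∀ n ≥ N, ∀ a : τ.T n ⟶ X, τ.s n ≫ a = 0 := by
  induction hX with
  | zero Z hZ => exact ⟨0, fun n _ a => hZ.eq_of_tgt _ _⟩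
  | extension E hE _ h₃ ih =>
    obtain ⟨N, hN⟩ := ih
    refine ⟨N + 1, fun n hn a => ?_⟩
    obtain ⟨m, rfl⟩ : ∃ m, n = m + 1 := ⟨n - 1, by omega⟩
    have := hE.mono_f
    -- A multiple of the top vanishes on `ι m`, so `ι m ≫ a` lands in `E.X₁`. Each filtration factor
    -- raises the bound by one.
    obtain ⟨c, hc⟩ := τ.eq_smul_top hS hP _ (a ≫ E.g ≫ h₃.some.hom)
    have h1 : (τ.ι m ≫ a) ≫ E.g = 0 := by
      rw [← cancel_mono h₃.some.hom, zero_comp, Category.assoc, Category.assoc, hc,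
        Linear.comp_smul, ι_top, smul_zero]
    have h2 := hN m (by omega) (hE.exact.lift _ h1)
    obtain ⟨d, hd, h3⟩ := τ.s_ι hS m
    have h4 : τ.s m ≫ τ.ι m ≫ a = 0 := by
      rw [← hE.exact.lift_f _ h1, reassoc_of% h2, zero_comp]
    rwa [← Category.assoc, h3, Linear.smul_comp, smul_eq_zero_iff_right hd] at h4

variable (hP : IsPaired k C)

/-- A morphism killed by a power of the nilpotent endomorphism factors through the projection. -/
theorem exists_factor_of_ev_eq_zero {m n : ℕ} (h : n ≤ m) {Y : C} (φ : τ.T m ⟶ Y)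
    (hφ : τ.ev m (Polynomial.X ^ (n + 1)) ≫ φ = 0) : ∃ ψ : τ.T n ⟶ Y, τ.proj h ≫ ψ = φ := by
  induction m, h using Nat.le_induction with
  | base => exact ⟨φ, by rw [proj_refl, Category.id_comp]⟩
  | succ m h ih =>
    have h1 : τ.ev (m + 1) (Polynomial.X ^ (m + 1)) ≫ φ = 0 := by
      have h0 : (Polynomial.X : Polynomial k) ^ (m + 1) =
          Polynomial.X ^ (m - n) * Polynomial.X ^ (n + 1) := by
        rw [← pow_add]
        congr 1
        omega
      rw [h0, ev_mul, Category.assoc, hφ, comp_zero]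
    obtain ⟨c, hc, h2⟩ := τ.ev_X_pow_self hS (m + 1)
    have h3 : τ.s (m + 1) ≫ φ = 0 := by
      rw [h2, Linear.smul_comp, smul_eq_zero_iff_right hc, Category.assoc] at h1
      rw [← cancel_epi (τ.top (m + 1)), h1, comp_zero]
    obtain ⟨φ', rfl⟩ := τ.exists_of_s_eq_zero m φ h3
    obtain ⟨ψ, hψ⟩ := ih φ' (by
      rw [← cancel_epi (τ.π m), comp_zero, ← Category.assoc, ← ev_π, Category.assoc, hφ])
    exact ⟨ψ, by rw [τ.proj_succ h, Category.assoc, hψ]⟩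

include hP

/-- Morphisms between members of the tower are polynomials in the nilpotent endomorphism. -/
theorem exists_eq_ev_proj {m n : ℕ} (h : n ≤ m) (f : τ.T m ⟶ τ.T n) :
    ∃ p : Polynomial k, f = τ.ev m p ≫ τ.proj h := by
  induction n with
  | zero =>
    obtain ⟨c, hc⟩ := τ.eq_smul_top hS hP m (f ≫ τ.top 0)
    refine ⟨Polynomial.C c, ?_⟩
    have : Mono (τ.top 0) := inferInstanceAs (Mono (inv (τ.s 0)))
    rw [ev_C, ← cancel_mono (τ.top 0), hc, τ.top_eq_proj h]
    simp
  | succ n ih =>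
    obtain ⟨p, hp⟩ := ih (by omega) (f ≫ τ.π n)
    have h1 : (f - τ.ev m p ≫ τ.proj h) ≫ τ.π n = 0 := by
      rw [Preadditive.sub_comp, Category.assoc, τ.proj_π (by omega) h, hp, sub_self]
    obtain ⟨g, hg⟩ := τ.exists_of_π_eq_zero n _ h1
    obtain ⟨c, rfl⟩ := τ.eq_smul_top hS hP m g
    -- The remaining error is a multiple of top followed by socle, which is a multiple of the power
    -- `n + 1`.
    obtain ⟨d, hd, h2⟩ := τ.ev_X_pow_self hS (n + 1)
    refine ⟨p + (c * d⁻¹) • Polynomial.X ^ (n + 1), ?_⟩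
    rw [ev_add, Preadditive.add_comp, ev_smul, Linear.smul_comp, ev_proj τ h (Polynomial.X ^ _), h2,
      Linear.comp_smul, smul_smul, mul_assoc, inv_mul_cancel₀ hd, mul_one, ← Category.assoc,
      ← τ.top_eq_proj h, ← Linear.smul_comp, hg]
    abel

theorem exists_eq_ev (n : ℕ) (f : τ.T n ⟶ τ.T n) : ∃ p : Polynomial k, f = τ.ev n p := by
  obtain ⟨p, hp⟩ := τ.exists_eq_ev_proj hS hP (le_refl n) f
  exact ⟨p, by rwa [proj_refl, Category.comp_id] at hp⟩

theorem isIso_of_s_comp_ne_zero (n : ℕ) (f : τ.T n ⟶ τ.T n) (hf : τ.s n ≫ f ≠ 0) : IsIso f := by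
  obtain ⟨p, rfl⟩ := τ.exists_eq_ev hS hP n f
  rw [s_ev] at hf
  exact τ.isIso_ev hS n p fun h => hf (by rw [h, zero_smul])

theorem isIso_of_comp_top_ne_zero (n : ℕ) (f : τ.T n ⟶ τ.T n) (hf : f ≫ τ.top n ≠ 0) :
    IsIso f := by
  obtain ⟨p, rfl⟩ := τ.exists_eq_ev hS hP n f
  rw [ev_top] at hf
  exact τ.isIso_ev hS n p fun h => hf (by rw [h, zero_smul])

theorem indecomposable (n : ℕ) : Indecomposable (τ.T n) := by
  refine indecomposable_of_idempotents (τ.not_isZero hS n) fun e he => ?_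
  by_cases h : τ.s n ≫ e = 0
  · left
    have : IsIso (𝟙 _ - e) := τ.isIso_of_s_comp_ne_zero hS hP n _ (by
      rw [Preadditive.comp_sub, h, sub_zero, Category.comp_id]
      exact τ.s_ne_zero hS n)
    rw [← cancel_mono (𝟙 _ - e), Preadditive.comp_sub, he, Category.comp_id, sub_self, zero_comp]
  · right
    have := τ.isIso_of_s_comp_ne_zero hS hP n e h
    rw [← cancel_epi e, he, Category.comp_id]

/-- A morphism from the socle which extends to `T n` but not to `T (n + 1)` exhibits `T n` as a
retract. -/
theorem exists_retraction (n : ℕ) {X : C} (a : τ.T n ⟶ X)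
    (h : ¬ ∃ b : τ.T (n + 1) ⟶ X, τ.s (n + 1) ≫ b = τ.s n ≫ a) : ∃ u : X ⟶ τ.T n, IsIso (a ≫ u) := by
  -- The obstruction provides `u` such that `l n` is nonzero on `s n ≫ a ≫ u`; so `a ≫ u` is nonzero
  -- on the socle.
  have h1 := (not_congr ((τ.pairing n).desc_iff (τ.s n ≫ a))).1 h
  push Not at h1
  obtain ⟨u, hu⟩ := h1
  refine ⟨u, τ.isIso_of_s_comp_ne_zero hS hP n _ fun h0 => hu ?_⟩
  rw [Category.assoc, h0, map_zero]

/-- The dual statement for the projections onto the top. -/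
theorem exists_section (n : ℕ) {X : C} (a : X ⟶ τ.T n)
    (h : ¬ ∃ b : X ⟶ τ.T (n + 1), b ≫ τ.top (n + 1) = a ≫ τ.top n) :
    ∃ u : τ.T n ⟶ X, IsIso (u ≫ a) := by
  obtain ⟨l, hl⟩ := hP.exists_pairing _ (τ.shortExact_ι_top hS n)
  have h1 := (not_congr (hl.lift_iff (a ≫ τ.top n))).1 h
  push Not at h1
  obtain ⟨u, hu⟩ := h1
  refine ⟨u, τ.isIso_of_comp_top_ne_zero hS hP n _ fun h0 => hu ?_⟩
  rw [← Category.assoc, h0, map_zero]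

/-- A map that is nonzero on the socle either passes from `T n` to `T (n + 1)` or makes `T n` a
retract of `X`. By `exists_bound` it cannot pass upwards forever. -/
theorem exists_iso {X : C} (hX : Indecomposable X) (hXS : IteratedSelfExt S X) :
    ∃ n, Nonempty (X ≅ τ.T n) := by
  by_contra! hcon
  have key : ∀ n, ∃ a : τ.T n ⟶ X, τ.s n ≫ a ≠ 0 := by
    intro n
    induction n with
    | zero =>
      obtain ⟨b, hb⟩ := hXS.exists_hom_left (𝟙 X) fun h => hX.1 ((IsZero.iff_id_eq_zero X).2 h)
      exact ⟨inv (τ.s 0) ≫ b, by rwa [IsIso.hom_inv_id_assoc]⟩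
    | succ n ih =>
      obtain ⟨a, ha⟩ := ih
      by_cases h : ∃ b : τ.T (n + 1) ⟶ X, τ.s (n + 1) ≫ b = τ.s n ≫ a
      · obtain ⟨b, hb⟩ := h
        exact ⟨b, by rwa [hb]⟩
      · obtain ⟨u, hu⟩ := τ.exists_retraction hS hP n a h
        have := (hX.isIso_of_isIso_comp (τ.not_isZero hS n) a u).1
        exact (hcon n).elim (asIso a).symm
  obtain ⟨N, hN⟩ := τ.exists_bound hS hP hXS
  obtain ⟨a, ha⟩ := key N
  exact ha (hN N le_rfl a)

/-- Morphisms to higher members of the tower vanish on the top. -/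
theorem comp_top_eq_zero {m n : ℕ} (h : m < n) (f : τ.T m ⟶ τ.T n) : f ≫ τ.top n = 0 := by
  by_contra hf
  have h1 := τ.isIso_of_comp_top_ne_zero hS hP n (τ.proj h.le ≫ f) fun h0 => hf (by
    rw [← cancel_epi (τ.proj h.le), comp_zero, ← Category.assoc, h0])
  have : Mono (τ.proj h.le) := mono_of_mono _ f
  obtain ⟨n, rfl⟩ : ∃ n', n = n' + 1 := ⟨n - 1, by omega⟩
  refine τ.s_ne_zero hS (n + 1) ?_
  rw [← cancel_mono (τ.proj h.le), τ.proj_succ (by omega), Tower.w_assoc, zero_comp]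

/-- Morphisms to lower members of the tower vanish on the socle. -/
theorem s_comp_eq_zero {m n : ℕ} (h : n < m) (f : τ.T m ⟶ τ.T n) : τ.s m ≫ f = 0 := by
  obtain ⟨p, rfl⟩ := τ.exists_eq_ev_proj hS hP h.le f
  obtain ⟨m, rfl⟩ : ∃ m', m = m' + 1 := ⟨m - 1, by omega⟩
  rw [← Category.assoc, s_ev, Linear.smul_comp, τ.proj_succ (by omega), Tower.w_assoc, smul_zero]

theorem eq_of_iso {m n : ℕ} (e : τ.T m ≅ τ.T n) : m = n := by
  have key : ∀ {m n : ℕ}, (τ.T m ≅ τ.T n) → ¬ n < m := fun {m n} e h =>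
    τ.s_ne_zero hS m (by
      rw [← cancel_mono e.hom, zero_comp, τ.s_comp_eq_zero hS hP h])
  exact le_antisymm (not_lt.1 (key e)) (not_lt.1 (key e.symm))

theorem exists_eq_ι_comp {m n : ℕ} (h : m < n) (f : τ.T m ⟶ τ.T n) :
    ∃ g : τ.T (m + 1) ⟶ τ.T n, τ.ι m ≫ g = f := by
  obtain ⟨l, hl⟩ := hP.exists_pairing _ (τ.shortExact_ι_top hS m)
  refine (hl.desc_iff f).2 fun u => ?_
  obtain ⟨c, rfl⟩ := τ.eq_smul_top hS hP n u
  rw [Linear.comp_smul, τ.comp_top_eq_zero hS hP h, smul_zero, map_zero]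

theorem exists_eq_π_comp {m n : ℕ} (h : n < m + 1) (f : τ.T (m + 1) ⟶ τ.T n) :
    ∃ g : τ.T m ⟶ τ.T n, τ.π m ≫ g = f :=
  τ.exists_of_s_eq_zero m f (τ.s_comp_eq_zero hS hP h f)

end Ladder

/-! ### The radical, irreducible morphisms and almost split sequences. -/

section Radical

variable {k : Type t} [Field k] {C : Type u} [Category.{v} C] [Abelian C] [Linear k C]

/-- The inverse is the one suggested by the geometric series. -/
theorem isIso_id_sub_comp_comm {X Y : C} (f : X ⟶ Y) (g : Y ⟶ X) (h : IsIso (𝟙 X - f ≫ g)) :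
    IsIso (𝟙 Y - g ≫ f) := by
  refine ⟨𝟙 Y + g ≫ inv (𝟙 X - f ≫ g) ≫ f, ?_, ?_⟩
  · have h1 : f ≫ g ≫ inv (𝟙 X - f ≫ g) ≫ f = inv (𝟙 X - f ≫ g) ≫ f - f := by
      have := IsIso.hom_inv_id_assoc (𝟙 X - f ≫ g) f
      rw [Preadditive.sub_comp, Category.id_comp, Category.assoc, sub_eq_iff_eq_add] at this
      exact eq_sub_of_add_eq' this.symm
    simp only [Preadditive.comp_add, Preadditive.sub_comp, Category.id_comp, Category.comp_id,
      Category.assoc, h1, Preadditive.comp_sub]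
    abel
  · have h1 : inv (𝟙 X - f ≫ g) ≫ f ≫ g ≫ f = inv (𝟙 X - f ≫ g) ≫ f - f := by
      have := IsIso.inv_hom_id_assoc (𝟙 X - f ≫ g) f
      rw [Preadditive.sub_comp, Category.id_comp, Category.assoc, Preadditive.comp_sub,
        sub_eq_iff_eq_add] at this
      exact eq_sub_of_add_eq' this.symm
    simp only [Preadditive.comp_sub, Preadditive.add_comp, Category.id_comp, Category.comp_id,
      Category.assoc, h1, Preadditive.comp_sub]
    abel

theorem mem_radical {X Y : C} {f : X ⟶ Y} : f ∈ radical k X Y ↔ ∀ g : Y ⟶ X, IsIso (𝟙 X - f ≫ g) :=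
  Iff.rfl

theorem mem_radical' {X Y : C} {f : X ⟶ Y} :
    f ∈ radical k X Y ↔ ∀ g : Y ⟶ X, IsIso (𝟙 Y - g ≫ f) :=
  ⟨fun h g => isIso_id_sub_comp_comm f g (h g), fun h g => isIso_id_sub_comp_comm g f (h g)⟩

theorem mem_radical_iff_left (hP : IsPaired k C) {X Y : C} (hX : Indecomposable X) {f : X ⟶ Y} :
    f ∈ radical k X Y ↔ ∀ g : Y ⟶ X, ¬ IsIso (f ≫ g) := by
  refine ⟨fun h g hg => hX.1 ?_, fun h g => hX.isIso_id_sub hP _ (h g)⟩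
  have h1 := mem_radical.1 h (g ≫ inv (f ≫ g))
  rw [← Category.assoc, IsIso.hom_inv_id, sub_self] at h1
  exact (IsZero.iff_id_eq_zero _).2 (by
    rw [← IsIso.hom_inv_id (0 : X ⟶ X), zero_comp])

theorem mem_radical_iff_right (hP : IsPaired k C) {X Y : C} (hY : Indecomposable Y) {f : X ⟶ Y} :
    f ∈ radical k X Y ↔ ∀ g : Y ⟶ X, ¬ IsIso (g ≫ f) := by
  refine ⟨fun h g hg => hY.1 ?_, fun h => mem_radical'.2 fun g => hY.isIso_id_sub hP _ (h g)⟩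
  have h1 := mem_radical'.1 h (inv (g ≫ f) ≫ g)
  rw [Category.assoc, IsIso.inv_hom_id, sub_self] at h1
  exact (IsZero.iff_id_eq_zero _).2 (by
    rw [← IsIso.hom_inv_id (0 : Y ⟶ Y), zero_comp])

theorem mem_radical_iff_not_isIso (hP : IsPaired k C) {X Y : C} (hX : Indecomposable X)
    (hY : Indecomposable Y) {f : X ⟶ Y} : f ∈ radical k X Y ↔ ¬ IsIso f := by
  rw [mem_radical_iff_left hP hX]
  refine ⟨fun h hf => h (inv f) (by rw [IsIso.hom_inv_id]; infer_instance), fun h g hg => h ?_⟩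
  exact (hY.isIso_of_isIso_comp hX.1 f g).1

theorem comp_mem_radicalSq {X Y Z : C} {f : X ⟶ Y} {g : Y ⟶ Z} (hf : f ∈ radical k X Y)
    (hg : g ∈ radical k Y Z) : f ≫ g ∈ radicalSq k X Z :=
  Submodule.subset_span ⟨Y, f, g, hf, hg, rfl⟩

theorem nontrivial_irr_iff {X Y : C} :
    Nontrivial (Irr k X Y) ↔ ∃ f ∈ radical k X Y, f ∉ radicalSq k X Y := by
  rw [Submodule.Quotient.nontrivial_iff, ne_eq, Submodule.submoduleOf,
    Submodule.comap_subtype_eq_top, SetLike.not_le_iff_exists]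

theorem finrank_irr_eq_zero {X Y : C} (h : radical k X Y ≤ radicalSq k X Y) :
    Module.Finite k (Irr k X Y) ∧ Module.finrank k (Irr k X Y) = 0 := by
  have : Subsingleton (Irr k X Y) := by
    rw [← not_nontrivial_iff_subsingleton, nontrivial_irr_iff]
    rintro ⟨f, hf, hf'⟩
    exact hf' (h hf)
  exact ⟨inferInstance, Module.finrank_zero_of_subsingleton⟩

theorem finrank_irr_eq_one {X Y : C} (f : X ⟶ Y) (hf : f ∈ radical k X Y)
    (hf' : f ∉ radicalSq k X Y) (h : ∀ g ∈ radical k X Y, ∃ c : k, g - c • f ∈ radicalSq k X Y) :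
    Module.Finite k (Irr k X Y) ∧ Module.finrank k (Irr k X Y) = 1 := by
  have h1 : Module.finrank k (Irr k X Y) = 1 := by
    refine finrank_eq_one (Submodule.Quotient.mk ⟨f, hf⟩) ?_ ?_
    · rw [ne_eq, Submodule.Quotient.mk_eq_zero]
      exact hf'
    · intro x
      obtain ⟨⟨g, hg⟩, rfl⟩ := Submodule.Quotient.mk_surjective _ x
      obtain ⟨c, hc⟩ := h g hg
      refine ⟨c, ?_⟩
      rw [← Submodule.Quotient.mk_smul, eq_comm, Submodule.Quotient.eq]
      exact hc
  exact ⟨Module.finite_of_finrank_eq_succ h1, h1⟩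

/-- An almost split sequence is obtained from a functional which vanishes on the
non-isomorphisms. -/
theorem exists_isAlmostSplit (hP : IsPaired k C) {X : C} (hX : Indecomposable X)
    (l : (X ⟶ X) →ₗ[k] k) (h1 : l (𝟙 X) ≠ 0) (h : ∀ f, ¬ IsIso f → l f = 0) :
    ∃ (E : C) (f : X ⟶ E) (g : E ⟶ X) (w : f ≫ g = 0), IsAlmostSplit (ShortComplex.mk f g w) := by
  obtain ⟨E, f, g, w, hl⟩ := hP.exists_shortComplex X X l
  refine ⟨E, f, g, w, hl.shortExact, hX, hX, ?_, ?_, ?_⟩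
  · rintro ⟨σ⟩
    have := (hl.desc_iff (𝟙 X)).1 ⟨σ.r, σ.f_r⟩ (𝟙 X)
    rw [Category.comp_id] at this
    exact h1 this
  · intro W j hj
    refine (hl.desc_iff j).2 fun u => h _ fun hu => hj ?_
    exact ⟨⟨u ≫ inv (j ≫ u), by rw [← Category.assoc, IsIso.hom_inv_id]⟩⟩
  · intro W j hj
    refine (hl.lift_iff j).2 fun u => h _ fun hu => hj ?_
    exact ⟨⟨inv (u ≫ j) ≫ u, by rw [Category.assoc, IsIso.inv_hom_id]⟩⟩

theorem IsAlmostSplit.comp_left_mem_radical (hP : IsPaired k C) {X E Z : C} {f : X ⟶ E}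
    {g : E ⟶ Z} {w : f ≫ g = 0} (h : IsAlmostSplit (ShortComplex.mk f g w)) :
    f ∈ radical k X E := by
  refine (mem_radical_iff_left hP h.indecomposable_left).2 fun r hr => h.not_split ⟨?_⟩
  exact ShortComplex.Splitting.ofExactOfRetraction _ h.shortExact.exact (r ≫ inv (f ≫ r))
    (by rw [← Category.assoc, IsIso.hom_inv_id]) h.shortExact.epi_g

theorem IsAlmostSplit.comp_right_mem_radical (hP : IsPaired k C) {X E Z : C} {f : X ⟶ E}
    {g : E ⟶ Z} {w : f ≫ g = 0} (h : IsAlmostSplit (ShortComplex.mk f g w)) :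
    g ∈ radical k E Z := by
  refine (mem_radical_iff_right hP h.indecomposable_right).2 fun r hr => h.not_split ⟨?_⟩
  exact ShortComplex.Splitting.ofExactOfSection _ h.shortExact.exact (inv (r ≫ g) ≫ r)
    (by rw [Category.assoc, IsIso.inv_hom_id]) h.shortExact.mono_f

/-- Targets of irreducible morphisms from the left term of an almost split sequence are summands
of its middle term. -/
theorem IsAlmostSplit.exists_retract_of_left (hP : IsPaired k C) {X E Z Y : C} {f : X ⟶ E}
    {g : E ⟶ Z} {w : f ≫ g = 0} (h : IsAlmostSplit (ShortComplex.mk f g w))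
    (hY : Indecomposable Y) (hXY : Nontrivial (Irr k X Y)) :
    ∃ (i : Y ⟶ E) (p : E ⟶ Y), i ≫ p = 𝟙 Y := by
  obtain ⟨j, hj, hj'⟩ := nontrivial_irr_iff.1 hXY
  obtain ⟨l, hl⟩ := h.left_almost_split Y j fun ⟨⟨σ⟩⟩ =>
    (mem_radical_iff_left hP h.indecomposable_left).1 hj σ.retraction
      (by rw [σ.id]; infer_instance)
  by_contra! hcon
  refine hj' (hl ▸ comp_mem_radicalSq (h.comp_left_mem_radical hP) ?_)
  refine (mem_radical_iff_right hP hY).2 fun r hr => hcon (inv (r ≫ l) ≫ r) l ?_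
  rw [Category.assoc, IsIso.inv_hom_id]

theorem IsAlmostSplit.exists_retract_of_right (hP : IsPaired k C) {X E Z Y : C} {f : X ⟶ E}
    {g : E ⟶ Z} {w : f ≫ g = 0} (h : IsAlmostSplit (ShortComplex.mk f g w))
    (hY : Indecomposable Y) (hYZ : Nontrivial (Irr k Y Z)) :
    ∃ (i : Y ⟶ E) (p : E ⟶ Y), i ≫ p = 𝟙 Y := by
  obtain ⟨j, hj, hj'⟩ := nontrivial_irr_iff.1 hYZ
  obtain ⟨l, hl⟩ := h.right_almost_split Y j fun ⟨⟨σ⟩⟩ =>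
    (mem_radical_iff_right hP h.indecomposable_right).1 hj σ.section_
      (by rw [σ.id]; infer_instance)
  by_contra! hcon
  refine hj' (hl ▸ comp_mem_radicalSq ?_ (h.comp_right_mem_radical hP))
  refine (mem_radical_iff_left hP hY).2 fun r hr => hcon l (r ≫ inv (l ≫ r)) ?_
  rw [← Category.assoc, IsIso.hom_inv_id]

end Radical

/-! ### The Auslander–Reiten component of the tower. -/

namespace Ladder

variable {k : Type t} [Field k] {C : Type u} [Category.{v} C] [Abelian C] [Linear k C]
  {S : C} (τ : Ladder k S) (hS : EndoSimple k S) (hP : IsPaired k C)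

include τ hS hP

theorem mem_radical_of_ne {m n : ℕ} (h : m ≠ n) (f : τ.T m ⟶ τ.T n) :
    f ∈ radical k (τ.T m) (τ.T n) :=
  (mem_radical_iff_not_isIso hP (τ.indecomposable hS hP m) (τ.indecomposable hS hP n)).2
    fun _ => h (τ.eq_of_iso hS hP (asIso f))

theorem mem_radical_self_iff {n : ℕ} (f : τ.T n ⟶ τ.T n) :
    f ∈ radical k (τ.T n) (τ.T n) ↔ τ.s n ≫ f = 0 := by
  rw [mem_radical_iff_not_isIso hP (τ.indecomposable hS hP n) (τ.indecomposable hS hP n)]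
  refine ⟨fun h => by_contra fun h' => h (τ.isIso_of_s_comp_ne_zero hS hP n f h'), fun h hf => ?_⟩
  exact τ.s_ne_zero hS n (by rw [← cancel_mono f, h, zero_comp])

theorem exists_sub_smul_mem_radical {n : ℕ} (f : τ.T n ⟶ τ.T n) :
    ∃ c : k, f - c • 𝟙 _ ∈ radical k (τ.T n) (τ.T n) := by
  obtain ⟨c, hc⟩ := τ.eq_smul_s hS n (τ.s n ≫ f)
  refine ⟨c, (τ.mem_radical_self_iff hS hP _).2 ?_⟩
  rw [Preadditive.comp_sub, hc, Linear.comp_smul, Category.comp_id, sub_self]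

/-- Let `f ≫ g` be nonzero on the socle. If `s n ≫ f` extends to `T (n + 1)`, then `g` has a section
up to an isomorphism; otherwise `f` has a retraction up to one. Either way a factor is not radical.
This keeps `ι n` out of `rad²`; the dual below does so for `π n`. -/
theorem s_comp_eq_zero_of_mem_radicalSq (n : ℕ) {f : τ.T n ⟶ τ.T (n + 1)}
    (hf : f ∈ radicalSq k (τ.T n) (τ.T (n + 1))) : τ.s n ≫ f = 0 := by
  refine (Submodule.span_le (p := LinearMap.ker (Linear.leftComp k _ (τ.s n)))).2 ?_ hf
  rintro _ ⟨Z, f, g, hf, hg, rfl⟩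
  change τ.s n ≫ f ≫ g = 0
  by_contra hne
  by_cases h : ∃ b : τ.T (n + 1) ⟶ Z, τ.s (n + 1) ≫ b = τ.s n ≫ f
  · obtain ⟨b, hb⟩ := h
    refine (mem_radical_iff_right hP (τ.indecomposable hS hP _)).1 hg b
      (τ.isIso_of_s_comp_ne_zero hS hP _ _ ?_)
    rwa [reassoc_of% hb]
  · obtain ⟨u, hu⟩ := τ.exists_retraction hS hP n f h
    exact (mem_radical_iff_left hP (τ.indecomposable hS hP _)).1 hf u hu

theorem comp_top_eq_zero_of_mem_radicalSq (n : ℕ) {f : τ.T (n + 1) ⟶ τ.T n}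
    (hf : f ∈ radicalSq k (τ.T (n + 1)) (τ.T n)) : f ≫ τ.top n = 0 := by
  refine (Submodule.span_le (p := LinearMap.ker (Linear.rightComp k _ (τ.top n)))).2 ?_ hf
  rintro _ ⟨Z, f, g, hf, hg, rfl⟩
  change (f ≫ g) ≫ τ.top n = 0
  rw [Category.assoc]
  by_contra hne
  by_cases h : ∃ b : Z ⟶ τ.T (n + 1), b ≫ τ.top (n + 1) = g ≫ τ.top n
  · obtain ⟨b, hb⟩ := h
    refine (mem_radical_iff_left hP (τ.indecomposable hS hP _)).1 hf b
      (τ.isIso_of_comp_top_ne_zero hS hP _ _ ?_)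
    rwa [Category.assoc, hb]
  · obtain ⟨u, hu⟩ := τ.exists_section hS hP n g h
    exact (mem_radical_iff_right hP (τ.indecomposable hS hP _)).1 hg u hu

/-- Maps upwards factor through `ι`, maps downwards and radical endomorphisms through `π`. Only
between neighbours can the remaining factor be non-radical, and there it is a scalar modulo the
radical. -/
theorem finrank_irr (m n : ℕ) : Module.Finite k (Irr k (τ.T m) (τ.T n)) ∧
    Module.finrank k (Irr k (τ.T m) (τ.T n)) = if n = m + 1 ∨ m = n + 1 then 1 else 0 := by
  rcases lt_trichotomy m n with h | rfl | h
  · rcases Nat.lt_or_ge (m + 1) n with h' | h'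
    · rw [if_neg (by omega)]
      refine finrank_irr_eq_zero fun f _ => ?_
      obtain ⟨g, rfl⟩ := τ.exists_eq_ι_comp hS hP h f
      exact comp_mem_radicalSq (τ.mem_radical_of_ne hS hP (by omega) _)
        (τ.mem_radical_of_ne hS hP (by omega) _)
    · obtain rfl : n = m + 1 := by omega
      rw [if_pos (Or.inl rfl)]
      refine finrank_irr_eq_one (τ.ι m) (τ.mem_radical_of_ne hS hP (by omega) _) (fun h0 => ?_) ?_
      · obtain ⟨c, hc, h1⟩ := τ.s_ι hS m
        rw [τ.s_comp_eq_zero_of_mem_radicalSq hS hP m h0] at h1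
        exact smul_ne_zero hc (τ.s_ne_zero hS _) h1.symm
      · intro f _
        obtain ⟨g, rfl⟩ := τ.exists_eq_ι_comp hS hP h f
        obtain ⟨c, hc⟩ := τ.exists_sub_smul_mem_radical hS hP g
        refine ⟨c, ?_⟩
        have := comp_mem_radicalSq (τ.mem_radical_of_ne hS hP (by omega) (τ.ι m)) hc
        rwa [Preadditive.comp_sub, Linear.comp_smul, Category.comp_id] at this
  · rw [if_neg (by omega)]
    refine finrank_irr_eq_zero fun f hf => ?_
    rw [τ.mem_radical_self_iff hS hP] at hf
    cases m with
    | zero =>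
      rw [(cancel_epi (τ.s 0)).1 (hf.trans comp_zero.symm)]
      exact zero_mem _
    | succ m =>
      obtain ⟨g, rfl⟩ := τ.exists_of_s_eq_zero m f hf
      exact comp_mem_radicalSq (τ.mem_radical_of_ne hS hP (by omega) _)
        (τ.mem_radical_of_ne hS hP (by omega) _)
  · obtain ⟨m, rfl⟩ : ∃ m', m = m' + 1 := ⟨m - 1, by omega⟩
    rcases Nat.lt_or_ge n m with h' | h'
    · rw [if_neg (by omega)]
      refine finrank_irr_eq_zero fun f _ => ?_
      obtain ⟨g, rfl⟩ := τ.exists_eq_π_comp hS hP h f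
      exact comp_mem_radicalSq (τ.mem_radical_of_ne hS hP (by omega) _)
        (τ.mem_radical_of_ne hS hP (by omega) _)
    · obtain rfl : n = m := by omega
      rw [if_pos (Or.inr rfl)]
      refine finrank_irr_eq_one (τ.π n) (τ.mem_radical_of_ne hS hP (by omega) _) (fun h0 => ?_) ?_
      · exact τ.top_ne_zero hS (n + 1) (τ.comp_top_eq_zero_of_mem_radicalSq hS hP n h0)
      · intro f _
        obtain ⟨g, rfl⟩ := τ.exists_eq_π_comp hS hP h f
        obtain ⟨c, hc⟩ := τ.exists_sub_smul_mem_radical hS hP g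
        refine ⟨c, ?_⟩
        have := comp_mem_radicalSq (τ.mem_radical_of_ne hS hP (by omega) (τ.π n)) hc
        rwa [Preadditive.comp_sub, Linear.comp_smul, Category.comp_id] at this

/-- On `T n` the functional `f ↦ l n (s n ≫ f)` works, since non-isomorphisms kill the socle. -/
theorem exists_isAlmostSplit {X : C} (hX : Indecomposable X) (hXS : IteratedSelfExt S X) :
    ∃ (E : C) (f : X ⟶ E) (g : E ⟶ X) (w : f ≫ g = 0), IsAlmostSplit (ShortComplex.mk f g w) := by
  obtain ⟨n, ⟨e⟩⟩ := τ.exists_iso hS hP hX hXS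
  refine OneCY.exists_isAlmostSplit hP hX
    (τ.l n ∘ₗ Linear.leftComp k _ (τ.s n) ∘ₗ Linear.leftComp k _ e.inv ∘ₗ
      Linear.rightComp k _ e.hom) ?_ fun f hf => ?_
  · simpa using τ.l_s n
  · change τ.l n (τ.s n ≫ e.inv ≫ f ≫ e.hom) = 0
    rw [(τ.mem_radical_self_iff hS hP _).1, map_zero]
    refine (mem_radical_iff_not_isIso hP (τ.indecomposable hS hP n)
      (τ.indecomposable hS hP n)).2 fun h => hf ?_
    have h1 : f = e.hom ≫ (e.inv ≫ f ≫ e.hom) ≫ e.inv := by simp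
    rw [h1]
    infer_instance

/-- The class of indecomposable iterated self-extensions of `S` is closed under irreducible
morphisms. -/
theorem iteratedSelfExt_of_irr [IsAlgClosed k] {A B : C} (hA : Indecomposable A) (hB : Indecomposable B)
    (h : Nontrivial (Irr k A B)) : IteratedSelfExt S A ↔ IteratedSelfExt S B := by
  constructor
  · intro hAS
    obtain ⟨E, f, g, w, hE⟩ := τ.exists_isAlmostSplit hS hP hA hAS
    obtain ⟨i, p, hip⟩ := hE.exists_retract_of_left hP hB h
    exact .of_retract hP hS (.of_shortExact hE.shortExact hAS hAS) hB i p hip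
  · intro hBS
    obtain ⟨E, f, g, w, hE⟩ := τ.exists_isAlmostSplit hS hP hB hBS
    obtain ⟨i, p, hip⟩ := hE.exists_retract_of_right hP hA h
    exact .of_retract hP hS (.of_shortExact hE.shortExact hBS hBS) hA i p hip

/-- The component cannot leave the class, because irreducible neighbours are summands of middle
terms of almost split sequences. It fills the class because every `T n` is joined to `T 0`. -/
theorem arComponent_iff [IsAlgClosed k] {X : C} (hX : Indecomposable X) (hXS : IteratedSelfExt S X) (Y : C) :
    ARComponent k X Y ↔ Indecomposable Y ∧ IteratedSelfExt S Y := by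
  constructor
  · rintro ⟨-, hY, h⟩
    refine ⟨hY, ?_⟩
    have key : ∀ A B : C, Relation.EqvGen (fun A B : C => Indecomposable A ∧ Indecomposable B ∧
        (Nonempty (A ≅ B) ∨ Nontrivial (Irr k A B))) A B →
        (IteratedSelfExt S A ↔ IteratedSelfExt S B) := by
      intro A B h
      induction h with
      | rel A B h =>
        obtain ⟨hA, hB, ⟨⟨e⟩⟩ | h⟩ := h
        · exact ⟨fun h => h.of_iso e, fun h => h.of_iso e.symm⟩
        · exact τ.iteratedSelfExt_of_irr hS hP hA hB h
      | refl A => rfl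
      | symm A B _ ih => exact ih.symm
      | trans A B D _ _ ih₁ ih₂ => exact ih₁.trans ih₂
    exact (key X Y h).1 hXS
  · rintro ⟨hY, hYS⟩
    refine ⟨hX, hY, ?_⟩
    have key : ∀ Z : C, Indecomposable Z → IteratedSelfExt S Z →
        Relation.EqvGen (fun A B : C => Indecomposable A ∧ Indecomposable B ∧
        (Nonempty (A ≅ B) ∨ Nontrivial (Irr k A B))) Z (τ.T 0) := by
      intro Z hZ hZS
      obtain ⟨n, e⟩ := τ.exists_iso hS hP hZ hZS
      refine (Relation.EqvGen.rel _ _ ⟨hZ, τ.indecomposable hS hP n, Or.inl e⟩).trans _ _ _ ?_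
      clear e
      induction n with
      | zero => exact .refl _
      | succ n ih =>
        refine .trans _ _ _ (.rel _ _ ⟨τ.indecomposable hS hP _, τ.indecomposable hS hP n,
          Or.inr ?_⟩) ih
        refine Module.nontrivial_of_finrank_pos (R := k) ?_
        rw [(τ.finrank_irr hS hP (n + 1) n).2, if_pos (Or.inr rfl)]
        exact one_pos
    exact (key X hX hXS).trans _ _ _ ((key Y hY hYS).symm _ _)

theorem isHomogeneousTube [IsAlgClosed k] {X : C} (hX : Indecomposable X) (hXS : IteratedSelfExt S X) :
    IsHomogeneousTube k (ARComponent k X) S := by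
  refine ⟨τ.T, ⟨(asIso (τ.s 0)).symm⟩, τ.indecomposable hS hP,
    fun m n ⟨e⟩ => τ.eq_of_iso hS hP e, fun Y => ?_, τ.finrank_irr hS hP, fun n => ?_⟩
  · rw [τ.arComponent_iff hS hP hX hXS]
    refine ⟨fun h => τ.exists_iso hS hP h.1 h.2, ?_⟩
    rintro ⟨n, ⟨e⟩⟩
    exact ⟨(τ.indecomposable hS hP n).of_iso e.symm, (τ.iteratedSelfExt n).of_iso e.symm⟩
  · obtain ⟨E, f, g, w, hE⟩ := τ.exists_isAlmostSplit hS hP (τ.indecomposable hS hP n)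
      (τ.iteratedSelfExt n)
    exact ⟨_, hE, ⟨Iso.refl _⟩, ⟨Iso.refl _⟩⟩

end Ladder

/-! ### Power series modules of morphisms out of the tower. -/

namespace Ladder

variable {k : Type t} [Field k] {C : Type u} [Category.{v} C] [Abelian C] [Linear k C]
  {S : C} (τ : Ladder k S) (hS : EndoSimple k S)

section

include hS

theorem ev_congr {n : ℕ} {p q : Polynomial k} (h : ∀ i ≤ n, p.coeff i = q.coeff i) :
    τ.ev n p = τ.ev n q := by
  obtain ⟨r, hr⟩ : Polynomial.X ^ (n + 1) ∣ p - q := Polynomial.X_pow_dvd_iff.2 fun i hi => by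
    rw [Polynomial.coeff_sub, h i (by omega), sub_self]
  rw [← sub_eq_zero, ← ev_sub, hr, ev_mul, τ.ev_X_pow_of_lt hS (Nat.lt_succ_self n), zero_comp]

end

/-- The action of power series in the nilpotent endomorphism. -/
def evSeries (n : ℕ) (f : PowerSeries k) : τ.T n ⟶ τ.T n := τ.ev n (f.trunc (n + 1))

theorem evSeries_one (n : ℕ) : τ.evSeries n 1 = 𝟙 _ := by
  rw [evSeries, PowerSeries.trunc_one, ev_one]

theorem evSeries_add (n : ℕ) (f g : PowerSeries k) :
    τ.evSeries n (f + g) = τ.evSeries n f + τ.evSeries n g := by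
  rw [evSeries, map_add, ev_add]
  rfl

theorem evSeries_zero (n : ℕ) : τ.evSeries n 0 = 0 := by
  rw [evSeries, map_zero, ev_zero]

theorem evSeries_C (n : ℕ) (c : k) : τ.evSeries n (PowerSeries.C c) = c • 𝟙 _ := by
  rw [evSeries, PowerSeries.trunc_C, ev_C]

include hS in
theorem evSeries_coe (n : ℕ) (p : Polynomial k) : τ.evSeries n p = τ.ev n p :=
  τ.ev_congr hS fun i hi => by
    rw [PowerSeries.coeff_trunc, if_pos (by omega), Polynomial.coeff_coe]

include hS in
theorem evSeries_mul (n : ℕ) (f g : PowerSeries k) :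
    τ.evSeries n (f * g) = τ.evSeries n f ≫ τ.evSeries n g := by
  rw [evSeries, ← PowerSeries.trunc_trunc_mul_trunc, ← Polynomial.coe_mul]
  exact (τ.evSeries_coe hS n _).trans (τ.ev_mul n _ _)

include hS in
theorem evSeries_proj {m n : ℕ} (h : n ≤ m) (f : PowerSeries k) :
    τ.evSeries m f ≫ τ.proj h = τ.proj h ≫ τ.evSeries n f := by
  rw [evSeries, ev_proj]
  congr 1
  refine τ.ev_congr hS fun i hi => ?_
  rw [PowerSeries.coeff_trunc, PowerSeries.coeff_trunc, if_pos (by omega), if_pos (by omega)]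

/-- Morphisms out of a member of the tower, as a module over power series. -/
@[nolint unusedArguments]
def HomFrom (_ : EndoSimple k S) (n : ℕ) (X : C) : Type v := τ.T n ⟶ X

instance (n : ℕ) (X : C) : AddCommGroup (τ.HomFrom hS n X) :=
  inferInstanceAs (AddCommGroup (τ.T n ⟶ X))

instance (n : ℕ) (X : C) : Module (PowerSeries k) (τ.HomFrom hS n X) where
  smul f a := τ.evSeries n f ≫ (a : τ.T n ⟶ X)
  one_smul := fun (a : τ.T n ⟶ X) => show τ.evSeries n 1 ≫ a = a by
    rw [evSeries_one, Category.id_comp]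
  mul_smul := fun f g (a : τ.T n ⟶ X) =>
    show τ.evSeries n (f * g) ≫ a = τ.evSeries n f ≫ τ.evSeries n g ≫ a by
      rw [τ.evSeries_mul hS, Category.assoc]
  smul_zero f := comp_zero
  smul_add f a b := Preadditive.comp_add _ _ _ _ _ _
  add_smul := fun f g (a : τ.T n ⟶ X) =>
    show τ.evSeries n (f + g) ≫ a = τ.evSeries n f ≫ a + τ.evSeries n g ≫ a by
      rw [evSeries_add, Preadditive.add_comp]
  zero_smul := fun (a : τ.T n ⟶ X) => show τ.evSeries n 0 ≫ a = 0 by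
    rw [evSeries_zero, zero_comp]

/-- The transition maps. -/
def transition (X : C) (i j : ℕ) (h : i ≤ j) :
    τ.HomFrom hS i X →ₗ[PowerSeries k] τ.HomFrom hS j X where
  toFun a := (τ.proj h ≫ (a : τ.T i ⟶ X) : τ.T j ⟶ X)
  map_add' a b := Preadditive.comp_add _ _ _ _ _ _
  map_smul' := fun f (a : τ.T i ⟶ X) =>
    show τ.proj h ≫ τ.evSeries i f ≫ a = τ.evSeries j f ≫ τ.proj h ≫ a by
      rw [← Category.assoc, ← τ.evSeries_proj hS h, Category.assoc]

instance (X : C) : DirectedSystem (τ.HomFrom hS · X) (τ.transition hS X · · ·) where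
  map_self := fun i (a : τ.T i ⟶ X) => show τ.proj le_rfl ≫ a = a by
    rw [proj_refl, Category.id_comp]
  map_map := fun l m n h h' (a : τ.T n ⟶ X) =>
    show τ.proj h' ≫ τ.proj h ≫ a = τ.proj (h.trans h') ≫ a by
      rw [← Category.assoc, proj_comp]

/-- Morphisms out of the whole tower, that is the direct limit of the modules of morphisms out of
its members. -/
abbrev Lim (X : C) : Type v := Module.DirectLimit (τ.HomFrom hS · X) (τ.transition hS X)

/-- The class in the direct limit of a morphism out of a member of the tower. -/
def toLim (n : ℕ) (X : C) : τ.HomFrom hS n X →ₗ[PowerSeries k] τ.Lim hS X :=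
  Module.DirectLimit.of (PowerSeries k) ℕ (τ.HomFrom hS · X) (τ.transition hS X) n

theorem toLim_proj {m n : ℕ} (h : n ≤ m) {X : C} (a : τ.T n ⟶ X) :
    τ.toLim hS m X (τ.proj h ≫ a : τ.T m ⟶ X) = τ.toLim hS n X a :=
  Module.DirectLimit.of_f (f := τ.transition hS X) (hij := h) (x := a)

theorem exists_toLim {X : C} (z : τ.Lim hS X) (n : ℕ) :
    ∃ (m : ℕ) (_ : n ≤ m) (a : τ.T m ⟶ X), τ.toLim hS m X a = z := by
  obtain ⟨i, a, ha⟩ := Module.DirectLimit.exists_of z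
  exact ⟨max n i, le_max_left _ _, _, (τ.toLim_proj hS (le_max_right n i) a).trans ha⟩

/-- The transition maps are precompositions with epimorphisms, hence injective. -/
theorem toLim_eq_zero_iff {n : ℕ} {X : C} (a : τ.T n ⟶ X) : τ.toLim hS n X a = 0 ↔ a = 0 := by
  refine ⟨fun h => ?_, fun h => by subst h; exact map_zero _⟩
  obtain ⟨j, hj, h⟩ := Module.DirectLimit.of.zero_exact h
  change τ.proj hj ≫ a = 0 at h
  rw [← cancel_epi (τ.proj hj), h, comp_zero]

theorem smul_toLim {n : ℕ} {X : C} (f : PowerSeries k) (a : τ.T n ⟶ X) :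
    f • τ.toLim hS n X a = τ.toLim hS n X (τ.evSeries n f ≫ a : τ.T n ⟶ X) :=
  (map_smul (τ.toLim hS n X) f (show τ.HomFrom hS n X from a)).symm

/-- Postcomposition on morphisms out of the tower. -/
def limMap {X Y : C} (f : X ⟶ Y) : τ.Lim hS X →ₗ[PowerSeries k] τ.Lim hS Y :=
  Module.DirectLimit.map (fun n =>
    { toFun := fun a => ((a : τ.T n ⟶ X) ≫ f : τ.T n ⟶ Y)
      map_add' := fun a b => Preadditive.add_comp _ _ _ _ _ _
      map_smul' := fun g a => Category.assoc _ _ _ }) fun i j h => by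
    ext a
    exact Category.assoc _ _ _

theorem limMap_toLim {X Y : C} (f : X ⟶ Y) {n : ℕ} (a : τ.T n ⟶ X) :
    τ.limMap hS f (τ.toLim hS n X a) = τ.toLim hS n Y (a ≫ f : τ.T n ⟶ Y) :=
  Module.DirectLimit.map_apply_of _ _ _

theorem lim_hom_ext {X : C} {M : Type*} [AddCommGroup M] [Module (PowerSeries k) M]
    {φ ψ : τ.Lim hS X →ₗ[PowerSeries k] M}
    (h : ∀ n (a : τ.T n ⟶ X), φ (τ.toLim hS n X a) = ψ (τ.toLim hS n X a)) : φ = ψ := by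
  refine LinearMap.ext fun z => ?_
  obtain ⟨n, -, a, rfl⟩ := τ.exists_toLim hS z 0
  exact h n a

theorem limMap_id (X : C) : τ.limMap hS (𝟙 X) = LinearMap.id :=
  τ.lim_hom_ext hS fun n a => by
    rw [limMap_toLim, Category.comp_id]
    rfl

theorem limMap_comp {X Y Z : C} (f : X ⟶ Y) (g : Y ⟶ Z) :
    τ.limMap hS (f ≫ g) = τ.limMap hS g ∘ₗ τ.limMap hS f :=
  τ.lim_hom_ext hS fun n a => by
    rw [LinearMap.comp_apply, limMap_toLim, limMap_toLim, limMap_toLim, Category.assoc]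

theorem limMap_add {X Y : C} (f g : X ⟶ Y) :
    τ.limMap hS (f + g) = τ.limMap hS f + τ.limMap hS g :=
  τ.lim_hom_ext hS fun n a => by
    rw [LinearMap.add_apply, limMap_toLim, limMap_toLim, limMap_toLim, Preadditive.comp_add]
    exact map_add (τ.toLim hS n Y) _ _

theorem limMap_zero (X Y : C) : τ.limMap hS (0 : X ⟶ Y) = 0 :=
  τ.lim_hom_ext hS fun n a => by
    rw [limMap_toLim, comp_zero]
    exact map_zero _

theorem limMap_smul {X Y : C} (c : k) (f : X ⟶ Y) (z : τ.Lim hS X) :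
    τ.limMap hS (c • f) z = (PowerSeries.C c : PowerSeries k) • τ.limMap hS f z := by
  obtain ⟨n, -, a, rfl⟩ := τ.exists_toLim hS z 0
  rw [limMap_toLim, limMap_toLim, smul_toLim, evSeries_C, Linear.smul_comp, Category.id_comp,
    Linear.comp_smul]

theorem limMap_limMap {X Y Z : C} (f : X ⟶ Y) (g : Y ⟶ Z) (z : τ.Lim hS X) :
    τ.limMap hS g (τ.limMap hS f z) = τ.limMap hS (f ≫ g) z := by
  rw [limMap_comp, LinearMap.comp_apply]

/-- The module of a biproduct. -/
def limBiprod (X Y : C) :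
    τ.Lim hS (X ⊞ Y) ≃ₗ[PowerSeries k] τ.Lim hS X × τ.Lim hS Y where
  toLinearMap := (τ.limMap hS biprod.fst).prod (τ.limMap hS biprod.snd)
  invFun z := τ.limMap hS biprod.inl z.1 + τ.limMap hS biprod.inr z.2
  left_inv z := by
    have h : τ.limMap hS (biprod.fst ≫ biprod.inl + biprod.snd ≫ biprod.inr) z = z := by
      rw [biprod.total (X := X) (Y := Y), limMap_id, LinearMap.id_apply]
    rwa [limMap_add, limMap_comp, limMap_comp] at h
  right_inv z := by
    change (τ.limMap hS biprod.fst (_ + _), τ.limMap hS biprod.snd (_ + _)) = z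
    simp [limMap_limMap, limMap_id, limMap_zero]

theorem subsingleton_lim {X : C} (hX : IsZero X) : Subsingleton (τ.Lim hS X) := by
  have h := τ.limMap_id hS X
  rw [hX.eq_of_src (𝟙 X) 0, limMap_zero] at h
  exact ⟨fun a b => (LinearMap.congr_fun h a).symm.trans (LinearMap.congr_fun h b)⟩

variable (hP : IsPaired k C)

include hP

/-- The module of an iterated self-extension of `S` is exhausted by a single member of the tower. -/
theorem exists_toLim_surjective {X : C} (hX : IteratedSelfExt S X) :
    ∃ n, Function.Surjective (τ.toLim hS n X) := by
  obtain ⟨N, hN⟩ := τ.exists_bound hS hP hX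
  refine ⟨N, fun z => ?_⟩
  obtain ⟨m, hm, a, rfl⟩ := τ.exists_toLim hS z N
  induction m, hm using Nat.le_induction with
  | base => exact ⟨a, rfl⟩
  | succ m hm ih =>
    obtain ⟨b, rfl⟩ := τ.exists_of_s_eq_zero m a (hN _ (by omega) a)
    rw [← proj_self_succ, toLim_proj]
    exact ih b

/-- The generator of the module of a member of the tower. -/
def gen (n : ℕ) : τ.Lim hS (τ.T n) := τ.toLim hS n (τ.T n) (𝟙 (τ.T n))

omit hP in
theorem limMap_gen {n : ℕ} {X : C} (a : τ.T n ⟶ X) :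
    τ.limMap hS a (τ.gen hS n) = τ.toLim hS n X a := by
  rw [gen, limMap_toLim, Category.id_comp]

theorem exists_eq_smul_gen (n : ℕ) (z : τ.Lim hS (τ.T n)) :
    ∃ f : PowerSeries k, f • τ.gen hS n = z := by
  obtain ⟨m, hm, a, rfl⟩ := τ.exists_toLim hS z n
  obtain ⟨p, rfl⟩ := τ.exists_eq_ev_proj hS hP hm a
  refine ⟨p, ?_⟩
  rw [gen, smul_toLim, τ.evSeries_coe hS, Category.comp_id, ev_proj, toLim_proj]

omit hP in
theorem X_pow_smul_gen (n : ℕ) : (PowerSeries.X ^ (n + 1) : PowerSeries k) • τ.gen hS n = 0 := by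
  rw [gen, smul_toLim, toLim_eq_zero_iff, Category.comp_id, ← Polynomial.coe_X,
    ← Polynomial.coe_pow, τ.evSeries_coe hS, τ.ev_X_pow_of_lt hS (Nat.lt_succ_self n)]

omit hP in
theorem X_pow_smul_gen_ne_zero (n : ℕ) : (PowerSeries.X ^ n : PowerSeries k) • τ.gen hS n ≠ 0 := by
  obtain ⟨c, hc, h⟩ := τ.ev_X_pow_self hS n
  rw [gen, smul_toLim, ne_eq, toLim_eq_zero_iff, Category.comp_id, ← Polynomial.coe_X,
    ← Polynomial.coe_pow, τ.evSeries_coe hS, h]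
  refine smul_ne_zero hc fun h0 => τ.s_ne_zero hS n ?_
  rw [← cancel_epi (τ.top n), h0, comp_zero]

omit hP in
theorem smul_gen_eq_zero_iff (n : ℕ) (f : PowerSeries k) :
    f • τ.gen hS n = 0 ↔ PowerSeries.X ^ (n + 1) ∣ f := by
  constructor
  · intro h
    by_contra hf
    have h0 : f ≠ 0 := by
      rintro rfl
      exact hf (dvd_zero _)
    obtain ⟨j, u, hu⟩ := IsDiscreteValuationRing.associated_pow_irreducible h0
      (PowerSeries.X_prime (R := k)).irreducible
    have hj : j ≤ n := by
      by_contra hj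
      exact hf ((pow_dvd_pow _ (show n + 1 ≤ j by omega)).trans ⟨↑u⁻¹, by rw [← hu, mul_assoc, u.mul_inv, mul_one]⟩)
    refine τ.X_pow_smul_gen_ne_zero hS n ?_
    obtain ⟨d, rfl⟩ := Nat.exists_eq_add_of_le hj
    rw [pow_add, ← hu, mul_comm, mul_comm f, ← mul_assoc, mul_smul, h, smul_zero]
  · rintro ⟨g, rfl⟩
    rw [mul_comm, mul_smul, X_pow_smul_gen, smul_zero]

/-- The module of a member of the tower is cyclic. -/
theorem nonempty_lim_equiv (n : ℕ) :
    Nonempty (τ.Lim hS (τ.T n) ≃ₗ[PowerSeries k]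
      PowerSeries k ⧸ Submodule.span (PowerSeries k) {(PowerSeries.X ^ (n + 1) : PowerSeries k)}) := by
  have h1 : Function.Surjective (LinearMap.toSpanSingleton (PowerSeries k) _ (τ.gen hS n)) :=
    τ.exists_eq_smul_gen hS hP n
  have h2 : Submodule.span (PowerSeries k) {(PowerSeries.X ^ (n + 1) : PowerSeries k)} =
      LinearMap.ker (LinearMap.toSpanSingleton (PowerSeries k) _ (τ.gen hS n)) := by
    ext f
    rw [LinearMap.mem_ker, LinearMap.toSpanSingleton_apply, τ.smul_gen_eq_zero_iff hS]
    exact Ideal.mem_span_singleton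
  exact ⟨(LinearMap.quotKerEquivOfSurjective _ h1).symm ≪≫ₗ
    (Submodule.quotEquivOfEq _ _ h2.symm)⟩

end Ladder

section

variable {k : Type t} [Field k] {C : Type u} [Category.{v} C] [Abelian C] [Linear k C] {S : C}

/-- To prove a property of all iterated self-extensions of `S`, it suffices to treat
indecomposable ones and biproducts. -/
theorem IteratedSelfExt.decomposition_induction [IsAlgClosed k] (hP : IsPaired k C)
    (hS : EndoSimple k S) {P : C → Prop}
    (iso : ∀ X Y, (X ≅ Y) → P X → P Y) (zero : ∀ X, IsZero X → P X)
    (indec : ∀ X, Indecomposable X → IteratedSelfExt S X → P X)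
    (biprod : ∀ X Y, P X → P Y → P (X ⊞ Y)) {X : C} (hX : IteratedSelfExt S X) : P X := by
  refine OneCY.decomposition_induction (k := k) hP (P := fun X =>
    (∀ (L : C) (i : L ⟶ X) (p : X ⟶ L), i ≫ p = 𝟙 L → Indecomposable L →
      IteratedSelfExt S L) → P X) ?_ ?_ ?_ ?_ X fun L i p hip hL => hX.of_retract hP hS hL i p hip
  · intro X Y e hX h
    exact iso X Y e (hX fun L i p hip hL => h L (i ≫ e.hom) (e.inv ≫ p) (by simpa using hip) hL)
  · exact fun X hX _ => zero X hX
  · exact fun X hX h => indec X hX (h X (𝟙 X) (𝟙 X) (Category.id_comp _) hX)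
  · intro X Y hX hY h
    exact biprod X Y
      (hX fun L i p hip hL => h L (i ≫ Limits.biprod.inl) (Limits.biprod.fst ≫ p) (by simpa using hip) hL)
      (hY fun L i p hip hL => h L (i ≫ Limits.biprod.inr) (Limits.biprod.snd ≫ p) (by simpa using hip) hL)

end

/-! ### Finite dimensional modules over power series. -/

section

variable {k : Type t} [Field k] {M : Type*} [AddCommGroup M] [Module (PowerSeries k) M] [Module k M]
  [IsScalarTower k (PowerSeries k) M] [Module.Finite k M]

/-- For dimension reasons some nonzero polynomial kills `m`; as a power series it is a unit times a
power of `X`. -/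
theorem exists_X_pow_smul_eq_zero (m : M) :
    ∃ n : ℕ, (PowerSeries.X ^ n : PowerSeries k) • m = 0 := by
  let φ : Polynomial k →ₗ[k] M :=
    (LinearMap.toSpanSingleton (PowerSeries k) M m).restrictScalars k ∘ₗ
      (Polynomial.coeToPowerSeries.algHom k).toLinearMap
  have hφ : ¬ Function.Injective φ := fun h =>
    Polynomial.not_finite (R := k) (Module.Finite.of_injective φ h)
  rw [injective_iff_map_eq_zero] at hφ
  push Not at hφ
  obtain ⟨p, hp, hp0⟩ := hφ
  have h1 : (p : PowerSeries k) • m = 0 := by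
    simpa [φ, Polynomial.coeToPowerSeries.algHom_apply] using hp
  obtain ⟨j, u, hu⟩ := IsDiscreteValuationRing.associated_pow_irreducible
    (fun h => hp0 (Polynomial.coe_eq_zero_iff.1 h)) (PowerSeries.X_prime (R := k)).irreducible
  exact ⟨j, by rw [← hu, mul_comm, mul_smul, h1, smul_zero]⟩

theorem exists_linearEquiv_pi_quotient_X_pow :
    ∃ (d : ℕ) (n : Fin d → ℕ), Nonempty (M ≃ₗ[PowerSeries k] ∀ i : Fin d, PowerSeries k ⧸
      Submodule.span (PowerSeries k) {(PowerSeries.X ^ n i : PowerSeries k)}) := by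
  have : Module.Finite (PowerSeries k) M := Module.Finite.of_restrictScalars_finite k _ M
  obtain ⟨d, n, ⟨e⟩⟩ := Module.torsion_by_prime_power_decomposition
    (PowerSeries.X_prime (R := k)).irreducible (M := M) (by
      rw [Submodule.isTorsion'_powers_iff]
      exact exists_X_pow_smul_eq_zero)
  exact ⟨d, n, ⟨e ≪≫ₗ DirectSum.linearEquivFunOnFintype _ _ _⟩⟩

end

/-! ### The equivalence with finite dimensional power series modules. -/

namespace Ladder

variable {k : Type t} [Field k] {C : Type u} [Category.{v} C] [Abelian C] [Linear k C]
  {S : C} (τ : Ladder k S) (hS : EndoSimple k S) (hP : IsPaired k C)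

section

include hP

/-- On `T n` a morphism is recovered from the image of the generator. -/
theorem limMap_injective [IsAlgClosed k] {X Y : C} (hX : IteratedSelfExt S X) {f : X ⟶ Y}
    (hf : τ.limMap hS f = 0) : f = 0 := by
  refine IteratedSelfExt.decomposition_induction hP hS (P := fun X => ∀ f : X ⟶ Y,
    τ.limMap hS f = 0 → f = 0) ?_ ?_ ?_ ?_ hX f hf
  · intro X X' e h f hf
    rw [← cancel_epi e.hom, comp_zero]
    exact h _ (by rw [limMap_comp, hf, LinearMap.zero_comp])
  · exact fun X hX f _ => hX.eq_of_src _ _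
  · intro X hX hXS f hf
    obtain ⟨n, ⟨e⟩⟩ := τ.exists_iso hS hP hX hXS
    rw [← cancel_epi e.inv, comp_zero, ← τ.toLim_eq_zero_iff hS, ← limMap_toLim, hf,
      LinearMap.zero_apply]
  · intro X X' h h' f hf
    apply biprod.hom_ext'
    · rw [h (biprod.inl ≫ f) (by rw [limMap_comp, hf, LinearMap.zero_comp]), comp_zero]
    · rw [h' (biprod.inr ≫ f) (by rw [limMap_comp, hf, LinearMap.zero_comp]), comp_zero]

/-- The image of the generator is represented by some `b : T m ⟶ Y`. It is killed by `X ^ (n + 1)`,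
so `b` factors through the projection to `T n`. -/
theorem limMap_surjective_of_tower (n : ℕ) {Y : C}
    (φ : τ.Lim hS (τ.T n) →ₗ[PowerSeries k] τ.Lim hS Y) : ∃ f, τ.limMap hS f = φ := by
  obtain ⟨m, hm, b, hb⟩ := τ.exists_toLim hS (φ (τ.gen hS n)) n
  obtain ⟨ψ, rfl⟩ := τ.exists_factor_of_ev_eq_zero hS hm b (by
    have h := congrArg φ (τ.X_pow_smul_gen hS n)
    rwa [map_smul, ← hb, smul_toLim, map_zero, toLim_eq_zero_iff, ← Polynomial.coe_X,
      ← Polynomial.coe_pow, τ.evSeries_coe hS] at h)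
  rw [toLim_proj, ← limMap_gen] at hb
  refine ⟨ψ, LinearMap.ext fun z => ?_⟩
  obtain ⟨f, rfl⟩ := τ.exists_eq_smul_gen hS hP n z
  rw [map_smul, map_smul, hb]

theorem limMap_surjective [IsAlgClosed k] {X Y : C} (hX : IteratedSelfExt S X)
    (φ : τ.Lim hS X →ₗ[PowerSeries k] τ.Lim hS Y) : ∃ f, τ.limMap hS f = φ := by
  have key : ∀ {X X' : C} (e : X ≅ X'),
      (∀ φ : τ.Lim hS X →ₗ[PowerSeries k] τ.Lim hS Y, ∃ f, τ.limMap hS f = φ) →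
      ∀ φ : τ.Lim hS X' →ₗ[PowerSeries k] τ.Lim hS Y, ∃ f, τ.limMap hS f = φ := by
    intro X X' e h φ
    obtain ⟨f, hf⟩ := h (φ ∘ₗ τ.limMap hS e.hom)
    refine ⟨e.inv ≫ f, ?_⟩
    rw [limMap_comp, hf, LinearMap.comp_assoc, ← limMap_comp, e.inv_hom_id, limMap_id,
      LinearMap.comp_id]
  refine IteratedSelfExt.decomposition_induction hP hS (P := fun X =>
    ∀ φ : τ.Lim hS X →ₗ[PowerSeries k] τ.Lim hS Y, ∃ f, τ.limMap hS f = φ)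
    (fun X X' e => key e) ?_ ?_ ?_ hX φ
  · intro X hX φ
    have := τ.subsingleton_lim hS hX
    exact ⟨0, Subsingleton.elim _ _⟩
  · intro X hX hXS
    obtain ⟨n, ⟨e⟩⟩ := τ.exists_iso hS hP hX hXS
    exact key e.symm (τ.limMap_surjective_of_tower hS hP n)
  · intro X X' h h' φ
    obtain ⟨f, hf⟩ := h (φ ∘ₗ τ.limMap hS biprod.inl)
    obtain ⟨f', hf'⟩ := h' (φ ∘ₗ τ.limMap hS biprod.inr)
    refine ⟨biprod.desc f f', ?_⟩
    rw [biprod.desc_eq, limMap_add, limMap_comp, limMap_comp, hf, hf', LinearMap.comp_assoc,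
      LinearMap.comp_assoc, ← LinearMap.comp_add, ← limMap_comp, ← limMap_comp, ← limMap_add,
      biprod.total, limMap_id, LinearMap.comp_id]

theorem exists_lim_equiv_quotient (n : ℕ) : ∃ X, IteratedSelfExt S X ∧
    Nonempty (τ.Lim hS X ≃ₗ[PowerSeries k] PowerSeries k ⧸
      Submodule.span (PowerSeries k) {(PowerSeries.X ^ n : PowerSeries k)}) := by
  cases n with
  | zero =>
    obtain ⟨Z, hZ⟩ := HasZeroObject.zero (C := C)
    have := τ.subsingleton_lim hS hZ
    have : Subsingleton (PowerSeries k ⧸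
        Submodule.span (PowerSeries k) {(PowerSeries.X ^ 0 : PowerSeries k)}) := by
      rw [Submodule.Quotient.subsingleton_iff, pow_zero]
      exact Ideal.span_singleton_one
    exact ⟨Z, .zero _ hZ, ⟨0⟩⟩
  | succ n => exact ⟨τ.T n, τ.iteratedSelfExt n, τ.nonempty_lim_equiv hS hP n⟩

theorem exists_lim_equiv_pi (d : ℕ) (n : Fin d → ℕ) : ∃ X, IteratedSelfExt S X ∧
    Nonempty (τ.Lim hS X ≃ₗ[PowerSeries k] ∀ i : Fin d, PowerSeries k ⧸
      Submodule.span (PowerSeries k) {(PowerSeries.X ^ n i : PowerSeries k)}) := by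
  induction d with
  | zero =>
    obtain ⟨Z, hZ⟩ := HasZeroObject.zero (C := C)
    have := τ.subsingleton_lim hS hZ
    exact ⟨Z, .zero _ hZ, ⟨0⟩⟩
  | succ d ih =>
    obtain ⟨X, hX, ⟨e⟩⟩ := τ.exists_lim_equiv_quotient hS hP (n 0)
    obtain ⟨X', hX', ⟨e'⟩⟩ := ih fun i => n i.succ
    exact ⟨X ⊞ X', hX.biprod hX', ⟨τ.limBiprod hS X X' ≪≫ₗ e.prodCongr e' ≪≫ₗ
      Fin.consLinearEquiv (PowerSeries k) fun i => PowerSeries k ⧸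
        Submodule.span (PowerSeries k) {(PowerSeries.X ^ n i : PowerSeries k)}⟩⟩

/-- The module of an iterated self-extension of `S` has a small model. -/
theorem exists_model {X : C} (hX : IteratedSelfExt S X) :
    ∃ M : (fdPowerSeriesModules k).FullSubcategory,
      Nonempty (τ.Lim hS X ≃ₗ[PowerSeries k] M.obj) := by
  obtain ⟨n, hn⟩ := τ.exists_toLim_surjective hS hP hX
  have : Module.Finite k (τ.T n ⟶ X) := hP.hom_finite _ _
  -- Morphisms live in universe `v`, the target modules in the universe `t` of `k`; finite
  -- dimensionality bridges the two.
  have : Small.{t} (τ.T n ⟶ X) := Module.Finite.small.{t} k _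
  have : Small.{t} (τ.Lim hS X) :=
    small_of_surjective (α := τ.T n ⟶ X) (f := fun a => τ.toLim hS n X a) hn
  let e : τ.Lim hS X ≃ₗ[PowerSeries k] Shrink.{t} (τ.Lim hS X) := (Shrink.linearEquiv _ _).symm
  let M : ModuleCat.{t} (PowerSeries k) := ModuleCat.of (PowerSeries k) (Shrink.{t} (τ.Lim hS X))
  refine ⟨⟨M, ?_⟩, ⟨e⟩⟩
  let : Module k M := ModuleCat.moduleOfAlgebraModule M
  let φ : (τ.T n ⟶ X) →ₗ[k] M :=
    { toFun := fun a => e (τ.toLim hS n X a)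
      map_add' := fun a b => by
        rw [← map_add]
        exact congrArg e (map_add (τ.toLim hS n X) _ _)
      map_smul' := fun c a => by
        change _ = (PowerSeries.C c : PowerSeries k) • e (τ.toLim hS n X a)
        rw [← map_smul, smul_toLim, evSeries_C, Linear.smul_comp, Category.id_comp] }
  exact Module.Finite.of_surjective φ (e.surjective.comp hn)

end

/-- The functor from iterated self-extensions of `S` to finite dimensional modules over power
series. -/
def functor : (IteratedSelfExt S).FullSubcategory ⥤ (fdPowerSeriesModules k).FullSubcategory where
  obj X := (τ.exists_model hS hP X.property).choose
  map {X Y} f := ObjectProperty.homMk (ModuleCat.ofHom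
    ((τ.exists_model hS hP Y.property).choose_spec.some.toLinearMap ∘ₗ τ.limMap hS f.hom ∘ₗ
      (τ.exists_model hS hP X.property).choose_spec.some.symm.toLinearMap))
  map_id X := by
    ext z
    simp [limMap_id]
  map_comp f g := by
    ext z
    simp [limMap_comp]

/-- The values of `Ladder.functor` are the modules of morphisms out of the tower. -/
def functorObjEquiv (X : (IteratedSelfExt S).FullSubcategory) :
    τ.Lim hS X.obj ≃ₗ[PowerSeries k] ((τ.functor hS hP).obj X).obj :=
  (τ.exists_model hS hP X.property).choose_spec.some

theorem functor_map_apply {X Y : (IteratedSelfExt S).FullSubcategory} (f : X ⟶ Y)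
    (z : ((τ.functor hS hP).obj X).obj) :
    ((τ.functor hS hP).map f).hom.hom z = τ.functorObjEquiv hS hP Y
      (τ.limMap hS f.hom ((τ.functorObjEquiv hS hP X).symm z)) := rfl

instance functor_additive : (τ.functor hS hP).Additive where
  map_add {X Y f g} := by
    ext z
    change ((τ.functor hS hP).map (f + g)).hom.hom z =
      ((τ.functor hS hP).map f).hom.hom z + ((τ.functor hS hP).map g).hom.hom z
    rw [functor_map_apply, functor_map_apply, functor_map_apply, ← map_add]
    congr 1
    exact LinearMap.congr_fun (τ.limMap_add hS f.hom g.hom) _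

instance functor_linear : (τ.functor hS hP).Linear k where
  map_smul {X Y} f c := by
    ext z
    change ((τ.functor hS hP).map (c • f)).hom.hom z =
      (PowerSeries.C c : PowerSeries k) • ((τ.functor hS hP).map f).hom.hom z
    rw [functor_map_apply, functor_map_apply, ← map_smul]
    congr 1
    exact τ.limMap_smul hS c f.hom _

theorem functor_faithful [IsAlgClosed k] : (τ.functor hS hP).Faithful where
  map_injective {X Y f g} h := by
    ext
    rw [← sub_eq_zero]
    refine τ.limMap_injective hS hP X.property (LinearMap.ext fun z => ?_)
    have h1 : ((τ.functor hS hP).map (f - g)).hom.hom (τ.functorObjEquiv hS hP X z) = 0 := by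
      rw [CategoryTheory.Functor.map_sub, h, sub_self]
      rfl
    rwa [functor_map_apply, LinearEquiv.symm_apply_apply, LinearEquiv.map_eq_zero_iff] at h1

theorem functor_full [IsAlgClosed k] : (τ.functor hS hP).Full where
  map_surjective {X Y} φ := by
    obtain ⟨f, hf⟩ := τ.limMap_surjective hS hP X.property
      ((τ.functorObjEquiv hS hP Y).symm.toLinearMap ∘ₗ φ.hom.hom ∘ₗ
        (τ.functorObjEquiv hS hP X).toLinearMap)
    refine ⟨ObjectProperty.homMk f, ?_⟩
    ext z
    rw [functor_map_apply]
    change τ.functorObjEquiv hS hP Y (τ.limMap hS f _) = _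
    simp [hf]

theorem functor_essSurj : (τ.functor hS hP).EssSurj where
  mem_essImage M := by
    let : Module k M.obj := ModuleCat.moduleOfAlgebraModule M.obj
    have : IsScalarTower k (PowerSeries k) M.obj := ModuleCat.isScalarTower_of_algebra_moduleCat _
    have : Module.Finite k M.obj := M.property
    obtain ⟨d, n, ⟨e⟩⟩ := exists_linearEquiv_pi_quotient_X_pow (k := k) (M := M.obj)
    obtain ⟨X, hX, ⟨e'⟩⟩ := τ.exists_lim_equiv_pi hS hP d n
    exact ⟨⟨X, hX⟩, ⟨ObjectProperty.isoMk _ (LinearEquiv.toModuleIso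
      ((τ.functorObjEquiv hS hP ⟨X, hX⟩).symm ≪≫ₗ e' ≪≫ₗ e.symm))⟩⟩

theorem functor_isEquivalence [IsAlgClosed k] : (τ.functor hS hP).IsEquivalence where
  faithful := τ.functor_faithful hS hP
  full := τ.functor_full hS hP
  essSurj := τ.functor_essSurj hS hP

end Ladder

end OneCY

end

theorem mainTheorem3 (k : Type t) [Field k] [IsAlgClosed k]
    (C : Type u) [Category.{v} C] [Abelian C] [Linear k C] [HasExt.{w} C]
    (hCY : OneCY.IsOneCalabiYau.{w} k C) (hconn : OneCY.IsConnectedAbelian C) :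
    -- every indecomposable is an iterated self-extension of a single endo-simple object
    (∀ X : C, Indecomposable X →
      ∃ S : C, OneCY.EndoSimple k S ∧ OneCY.IteratedSelfExt S X ∧
        ∀ S' : C, OneCY.EndoSimple k S' → OneCY.IteratedSelfExt S' X → Nonempty (S' ≅ S)) ∧
    -- every Auslander–Reiten component is a homogeneous tube based on an endo-simple object `S`,
    -- and consists of the indecomposable iterated self-extensions of `S`
    (∀ X : C, Indecomposable X →
      ∃ S : C, OneCY.EndoSimple k S ∧
        OneCY.IsHomogeneousTube k (OneCY.ARComponent k X) S ∧
        ∀ Y : C, OneCY.ARComponent k X Y ↔ Indecomposable Y ∧ OneCY.IteratedSelfExt S Y) ∧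
    -- the iterated self-extensions of an endo-simple object form a category which is
    -- `k`-linearly equivalent to the finite dimensional `k[[t]]`-modules
    (∀ S : C, OneCY.EndoSimple k S →
      ∃ e : (OneCY.IteratedSelfExt S).FullSubcategory ≌
          (OneCY.fdPowerSeriesModules k).FullSubcategory,
        e.functor.Additive ∧ e.functor.Linear k) ∧
    -- every cycle `X 0 ⟶ X 1 ⟶ ⋯ ⟶ X n ⟶ X 0` of nonzero non-isomorphisms between
    -- indecomposable objects lies in a single homogeneous tube
    (∀ (n : ℕ) (X : Fin (n + 1) → C) (f : ∀ i, X i ⟶ X (i + 1)),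
      (∀ i, Indecomposable (X i)) → (∀ i, f i ≠ 0 ∧ ¬ IsIso (f i)) →
      ∃ S : C, OneCY.EndoSimple k S ∧
        OneCY.IsHomogeneousTube k (OneCY.ARComponent k S) S ∧
        ∀ i, OneCY.ARComponent k S (X i)) := by
  have hP : OneCY.IsPaired k C := hCY.isPaired
  refine ⟨fun X hX => ?_, fun X hX => ?_, fun S hS => ?_, fun n X f hX hf => ?_⟩
  · obtain ⟨S, hS, hSX⟩ := OneCY.exists_endoSimple hP X hX
    exact ⟨S, hS, hSX, fun S' hS' h => h.nonempty_iso hP hS' hS hX.1 hSX⟩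
  · obtain ⟨S, hS, hSX⟩ := OneCY.exists_endoSimple hP X hX
    obtain ⟨τ⟩ := OneCY.nonempty_ladder hP hS
    exact ⟨S, hS, τ.isHomogeneousTube hS hP hX hSX, τ.arComponent_iff hS hP hX hSX⟩
  · obtain ⟨τ⟩ := OneCY.nonempty_ladder hP hS
    have := τ.functor_isEquivalence hS hP
    exact ⟨(τ.functor hS hP).asEquivalence, τ.functor_additive hS hP, τ.functor_linear hS hP⟩
  · choose S hS hSX using fun i => OneCY.exists_endoSimple hP (X i) (hX i)
    obtain ⟨τ⟩ := OneCY.nonempty_ladder hP (hS 0)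
    have hS0 := (hS 0).indecomposable
    refine ⟨S 0, hS 0, τ.isHomogeneousTube (hS 0) hP hS0 (.self _), fun i => ?_⟩
    obtain ⟨e⟩ := OneCY.nonempty_iso_of_cycle hP n X S f (fun i => (hf i).1) hS hSX i
    exact (τ.arComponent_iff (hS 0) hP hS0 (.self _) (X i)).2 ⟨hX i, (hSX i).congr e⟩
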